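/- Let $\mathfrak g=\mathfrak g_{\bar 0}\oplus\mathfrak g_{\bar 1}$ be a finite-dimensional Lie superalgebra over $\mathbb C$ with $\mathfrak g_{\bar 0}$ reductive, with a commutative subalgebra $\mathfrak h\subset\mathfrak g_{\bar 0}$ giving a root space decomposition $\mathfrak g=\mathfrak h\oplus\bigoplus_{\alpha\in\Delta}\mathfrak g_\alpha$, $\Delta\subset\mathfrak h^*\setminus\{0\}$, and with a nondegenerate even supersymmetric invariant bilinear form; $(\cdot,\cdot)$ also denotes the induced form on $\mathfrak h^*$. (Examples: $\mathfrak{gl}(m|n)$ and all finite-dimensional contragredient Lie superalgebras with indecomposable Cartan matrix, that is $\mathfrak{sl}(m|n)$ with $m\neq n$, $\mathfrak{gl}(n|n)$, $\mathfrak{osp}(m|2n)$, $D(2,1,\alpha)$, $F(4)$, $G(3)$.) For a finite-dimensional $\mathfrak g$-module $M$ with (generalised) weight spaces $M^\mu=M^\mu_{\bar 0}\oplus M^\mu_{\bar 1}$, let $\operatorname{sch}M=\sum_\mu(\dim M^\mu_{\bar 0}-\dim M^\mu_{\bar 1})e^\mu\in\mathbb Z[\mathfrak h^*]$, and let $\mathcal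 J_{\mathfrak g}\subset\mathbb Z[\mathfrak h^*]$ be the additive span of all $\operatorname{sch}M$ (the supercharacter ring). For $y\in\mathfrak g_{\bar 1}$ with $[y,y]=0$ put $\mathfrak g^y=\{a\in\mathfrak g:[y,a]=0\}$, $\mathfrak g_y=\mathfrak g^y/[y,\mathfrak g]$, let $\mathfrak h_y$ be the image of $\mathfrak h\cap\mathfrak g^y$ in $\mathfrak g_y$, and for a $\mathfrak g$-module $M$ let $M_y=\operatorname{Ker}_M y/yM$, a $\mathfrak g_y$-module. The map $ds_y:\mathcal J_{\mathfrak g}\to\mathcal J_{\mathfrak g_y}$, where $\mathcal J_{\mathfrak g_y}\subset\mathbb Z[\mathfrak h_y^*]$, is the well-defined additive map with $ds_y(\operatorname{sch}M)=\operatorname{sch}M_y$. Let $\beta_1,\dots,\beta_k\in\Delta$ be linearly independent, mutually orthogonal, isotropic odd roots, let $x_{\beta_i}\in(\mathfrak g_{\beta_i})_{\bar 1}$, and let $x=x_{\beta_1}+\cdots+x_{\beta_k}$. Then: * $[x_{\beta_i},x_{\beta_j}]=0$ for all $i,j$. Hence $[x,x]=0$, and the algebra $\mathfrak g'=(\cdots((\mathfrak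 g_{x_{\beta_k}})_{x_{\beta_{k-1}}})\cdots)_{x_{\beta_1}}$ is defined; at each step $x_{\beta_i}$ stands for its class. * There is an isomorphism of Lie superalgebras $\Phi:\mathfrak g_x\to\mathfrak g'$ that maps $\mathfrak h_x$ onto the corresponding subspace $\mathfrak h'$ of $\mathfrak g'$ and sends the class of every homogeneous $a\in\bigcap_i\mathfrak g^{x_{\beta_i}}$ in $\mathfrak g_x$ to its class in $\mathfrak g'$. * Under the identification $\mathbb Z[\mathfrak h_x^*]\cong\mathbb Z[\mathfrak h'^*]$ induced by $\Phi$, for all $f\in\mathcal J_{\mathfrak g}$ $$ds_x(f)=ds_{x_{\beta_1}}\circ\cdots\circ ds_{x_{\beta_k}}(f).$$ -/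

import Mathlib

universe u

noncomputable section

namespace DufloSerganova

section Weights

variable {t t' V W Q : Type*} [AddCommGroup t] [Module ℂ t] [AddCommGroup t'] [Module ℂ t']
  [AddCommGroup V] [Module ℂ V] [AddCommGroup W] [Module ℂ W] [AddCommGroup Q] [Module ℂ Q]

/-- The weight space `V^μ` of a space with commuting operators `T a`, as a joint generalised
eigenspace. It is the ordinary weight space whenever the operators are diagonalisable. -/
def weightSpace (T : t →ₗ[ℂ] Module.End ℂ V) (μ : Module.Dual ℂ t) : Submodule ℂ V :=
  ⨅ a : t, (T a).maxGenEigenspace (μ a)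

theorem mem_weightSpace (T : t →ₗ[ℂ] Module.End ℂ V) (μ : Module.Dual ℂ t) (v : V) :
    v ∈ weightSpace T μ ↔ ∀ a, ∃ k : ℕ, ((T a - μ a • (1 : Module.End ℂ V)) ^ k) v = 0 := by
  simp [weightSpace]

theorem weightSpace_indep (T : t →ₗ[ℂ] Module.End ℂ V) (hT : ∀ a b, Commute (T a) (T b)) :
    iSupIndep (weightSpace T) := by
  have h := Module.End.independent_iInf_maxGenEigenspace_of_forall_mapsTo (fun a => T a)
    (fun i j φ => Module.End.mapsTo_maxGenEigenspace_of_comm (hT j i) φ)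
  exact h.comp (f := fun μ : Module.Dual ℂ t => (μ : t → ℂ)) DFunLike.coe_injective

theorem scalar_eq_zero {c : ℂ} {S : Module.End ℂ V} (hS : ∀ v, S v = c • v)
    {v : V} (hv : v ≠ 0) {k : ℕ} (h : (S ^ k) v = 0) : c = 0 := by
  have : ∀ k : ℕ, (S ^ k) v = c ^ k • v := by
    intro k
    induction k with
    | zero => simp
    | succ k ih => rw [pow_succ', Module.End.mul_apply, ih, hS, smul_smul, pow_succ']
  rw [this] at h
  rcases smul_eq_zero.mp h with h | h
  · exact by_contra fun hc => pow_ne_zero k hc h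
  · exact absurd h hv

theorem exists_pow_add {A B : Module.End ℂ V} (h : Commute A B) {v : V} {k l : ℕ}
    (hA : (A ^ k) v = 0) (hB : (B ^ l) v = 0) : ((A + B) ^ (k + l)) v = 0 := by
  rw [h.add_pow']
  rw [LinearMap.sum_apply]
  refine Finset.sum_eq_zero fun ⟨i, j⟩ hij => ?_
  replace hij : i + j = k + l := Finset.HasAntidiagonal.mem_antidiagonal.mp hij
  rw [LinearMap.smul_apply]
  dsimp only
  rcases le_or_gt k i with hi | hi
  · obtain ⟨d, rfl⟩ := Nat.exists_eq_add_of_le hi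
    rw [(h.pow_pow _ _).eq, pow_add, (Commute.pow_pow_self A k d).eq]
    simp [Module.End.mul_apply, hA]
  · have : l ≤ j := by omega
    obtain ⟨d, rfl⟩ := Nat.exists_eq_add_of_le this
    rw [pow_add, (Commute.pow_pow_self B l d).eq]
    simp [Module.End.mul_apply, hB]

theorem weight_linear (T : t →ₗ[ℂ] Module.End ℂ V) (hT : ∀ a b, Commute (T a) (T b))
    (χ : t → ℂ) {v : V} (hv : v ≠ 0) (h : ∀ a, ∃ k : ℕ, ((T a - χ a • (1 : Module.End ℂ V)) ^ k) v = 0) :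
    ∃ μ : Module.Dual ℂ t, ∀ a, μ a = χ a := by
  have hc : ∀ (a b : t) (c d : ℂ), Commute (T a - c • (1 : Module.End ℂ V))
      (T b - d • (1 : Module.End ℂ V)) := fun a b c d =>
    (((hT a b).sub_right ((Commute.one_right _).smul_right _))).sub_left
      ((Commute.one_left _).smul_left _)
  refine ⟨{ toFun := χ, map_add' := fun a b => ?_, map_smul' := fun c a => ?_ }, fun _ => rfl⟩
  · obtain ⟨k, hk⟩ := h a
    obtain ⟨l, hl⟩ := h b
    obtain ⟨m, hm⟩ := h (a + b)
    have h1 := exists_pow_add (hc a b _ _) hk hl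
    have hm' : ((-(T (a + b) - χ (a + b) • (1 : Module.End ℂ V))) ^ m) v = 0 := by
      rw [neg_pow]
      simp only [Module.End.mul_apply, hm, map_zero]
    have hcomm : Commute (T a - χ a • (1 : Module.End ℂ V) + (T b - χ b • (1 : Module.End ℂ V)))
        (-(T (a + b) - χ (a + b) • (1 : Module.End ℂ V))) :=
      ((hc a (a + b) _ _).add_left (hc b (a + b) _ _)).neg_right
    have h2 := exists_pow_add hcomm h1 hm'
    have := scalar_eq_zero (c := χ (a + b) - (χ a + χ b)) (fun w => by
      simp [add_smul, sub_smul]; abel) hv h2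
    exact sub_eq_zero.mp this
  · obtain ⟨k, hk⟩ := h a
    obtain ⟨m, hm⟩ := h (c • a)
    have hk' : ((-(c • (T a - χ a • (1 : Module.End ℂ V)))) ^ k) v = 0 := by
      rw [neg_pow, smul_pow]
      simp only [Module.End.mul_apply, LinearMap.smul_apply, hk, smul_zero, map_zero]
    have h2 := exists_pow_add (((hc (c • a) a _ _).smul_right c).neg_right) hm hk'
    have := scalar_eq_zero (c := c * χ a - χ (c • a)) (fun w => by
      simp [sub_smul, smul_sub, smul_smul]) hv h2
    simpa using (sub_eq_zero.mp this).symm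

theorem weightSpace_iSup [FiniteDimensional ℂ V] (T : t →ₗ[ℂ] Module.End ℂ V)
    (hT : ∀ a b, Commute (T a) (T b)) : ⨆ μ, weightSpace T μ = ⊤ := by
  have h := Module.End.iSup_iInf_maxGenEigenspace_eq_top_of_forall_mapsTo (fun a => T a)
    (fun i j φ => Module.End.mapsTo_maxGenEigenspace_of_comm (hT j i) φ)
    (fun a => Module.End.iSup_maxGenEigenspace_eq_top _)
  rw [eq_top_iff, ← h]
  refine iSup_le fun χ => ?_
  by_cases hb : (⨅ i, (T i).maxGenEigenspace (χ i)) = ⊥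
  · rw [hb]; exact bot_le
  · obtain ⟨v, hv, hv0⟩ := (Submodule.ne_bot_iff _).mp hb
    rw [Module.End.mem_iInf_maxGenEigenspace_iff] at hv
    obtain ⟨μ, hμ⟩ := weight_linear T hT χ hv0 hv
    refine le_trans (le_of_eq ?_) (le_iSup (weightSpace T) μ)
    simp [weightSpace, hμ]

theorem finite_weights [FiniteDimensional ℂ V] (T : t →ₗ[ℂ] Module.End ℂ V)
    (hT : ∀ a b, Commute (T a) (T b)) :
    (Function.support fun μ => (Module.finrank ℂ (weightSpace T μ) : ℤ)).Finite := by
  refine (WellFoundedGT.finite_ne_bot_of_iSupIndep (weightSpace_indep T hT)).subset ?_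
  intro μ hμ
  simp only [Function.mem_support, ne_eq, Nat.cast_eq_zero] at hμ
  intro hb
  apply hμ
  rw [hb]; simp

/-- The character `∑ dim V^μ e^μ`. -/
def character [FiniteDimensional ℂ V] (T : t →ₗ[ℂ] Module.End ℂ V)
    (hT : ∀ a b, Commute (T a) (T b)) : AddMonoidAlgebra ℤ (Module.Dual ℂ t) :=
  .ofCoeff (Finsupp.ofSupportFinite _ (finite_weights T hT))

theorem character_apply [FiniteDimensional ℂ V] (T : t →ₗ[ℂ] Module.End ℂ V)
    (hT : ∀ a b, Commute (T a) (T b)) (μ : Module.Dual ℂ t) :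
    (character T hT).coeff μ = Module.finrank ℂ (weightSpace T μ) := rfl

/-- Sum of coefficients. -/
def total {X : Type*} : (X →₀ ℤ) →+ ℤ := Finsupp.liftAddHom fun _ => AddMonoidHom.id ℤ

theorem total_character [FiniteDimensional ℂ V] (T : t →ₗ[ℂ] Module.End ℂ V)
    (hT : ∀ a b, Commute (T a) (T b)) :
    total (character T hT).coeff = Module.finrank ℂ V := by
  classical
  have hfin := WellFoundedGT.finite_ne_bot_of_iSupIndep (weightSpace_indep T hT)
  have hind : iSupIndep fun μ : hfin.toFinset => weightSpace T μ :=
    (weightSpace_indep T hT).comp Subtype.val_injective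
  have hsup : ⨆ μ : hfin.toFinset, weightSpace T μ = ⊤ := by
    rw [eq_top_iff, ← weightSpace_iSup T hT]
    refine iSup_le fun μ => ?_
    by_cases hb : weightSpace T μ = ⊥
    · rw [hb]; exact bot_le
    · exact le_iSup (fun μ : hfin.toFinset => weightSpace T μ) ⟨μ, by simpa using hb⟩
  have hint := DirectSum.isInternal_submodule_of_iSupIndep_of_iSup_eq_top hind hsup
  have e := LinearEquiv.ofBijective (DirectSum.coeLinearMap _) hint
  have h1 := e.finrank_eq
  rw [Module.finrank_directSum] at h1
  rw [← h1, Finset.sum_coe_sort hfin.toFinset (fun μ => Module.finrank ℂ (weightSpace T μ))]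
  simp only [total, Finsupp.liftAddHom_apply]
  rw [Finsupp.sum_of_support_subset (s := hfin.toFinset)]
  · simp [character_apply]
  · intro μ hμ
    simp only [Finsupp.mem_support_iff, ne_eq, character_apply] at hμ
    simp only [Set.Finite.mem_toFinset, Set.mem_ofPred_eq]
    intro hb
    apply hμ
    rw [hb]
    simp
  · simp

theorem eq_of_le_of_total {X : Type*} {f g : X →₀ ℤ} (h : ∀ x, f x ≤ g x)
    (ht : total g ≤ total f) : f = g := by
  classical
  have h0 : ∀ x, 0 ≤ (g - f) x := fun x => by simpa using h x
  have h1 : total (g - f) ≤ 0 := by rw [map_sub]; linarith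
  have h2 : (g - f) = 0 := by
    ext x
    simp only [total, Finsupp.liftAddHom_apply, AddMonoidHom.id_apply, Finsupp.sum] at h1
    by_contra hx
    have hx' : x ∈ (g - f).support := Finsupp.mem_support_iff.mpr hx
    have := Finset.single_le_sum (fun y _ => h0 y) hx'
    have h3 := h0 x
    have h4 : (g - f) x ≠ 0 := hx
    omega
  exact (sub_eq_zero.mp h2).symm

theorem intertwine_pow {T : Module.End ℂ V} {S : Module.End ℂ W} {f : V →ₗ[ℂ] W}
    (h : ∀ v, f (T v) = S (f v)) (c : ℂ) (k : ℕ) (v : V) :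
    f (((T - c • (1 : Module.End ℂ V)) ^ k) v) = ((S - c • (1 : Module.End ℂ W)) ^ k) (f v) := by
  induction k with
  | zero => simp
  | succ k ih => simp [pow_succ', Module.End.mul_apply, ← ih, h]

theorem character_exact [FiniteDimensional ℂ V] [FiniteDimensional ℂ W] [FiniteDimensional ℂ Q]
    {S : t →ₗ[ℂ] Module.End ℂ W} {T : t →ₗ[ℂ] Module.End ℂ V} {R : t →ₗ[ℂ] Module.End ℂ Q}
    (hS : ∀ a b, Commute (S a) (S b)) (hT : ∀ a b, Commute (T a) (T b))
    (hR : ∀ a b, Commute (R a) (R b))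
    (i : W →ₗ[ℂ] V) (p : V →ₗ[ℂ] Q) (hi : Function.Injective i) (hp : Function.Surjective p)
    (hip : LinearMap.range i = LinearMap.ker p)
    (hiS : ∀ a w, i (S a w) = T a (i w)) (hpT : ∀ a v, p (T a v) = R a (p v)) :
    character T hT = character S hS + character R hR := by
  apply AddMonoidAlgebra.coeff_injective
  rw [AddMonoidAlgebra.coeff_add]
  apply eq_of_le_of_total
  · intro μ
    simp only [Finsupp.coe_add, Pi.add_apply, character_apply]
    norm_cast
    have hmap : ∀ v ∈ weightSpace T μ, p v ∈ weightSpace R μ := by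
      intro v hv
      rw [mem_weightSpace] at hv ⊢
      intro a
      obtain ⟨k, hk⟩ := hv a
      exact ⟨k, by rw [← intertwine_pow (hpT a), hk, map_zero]⟩
    let q : weightSpace T μ →ₗ[ℂ] weightSpace R μ := p.restrict hmap
    have hr := LinearMap.finrank_range_add_finrank_ker q
    have h1 : Module.finrank ℂ (LinearMap.range q) ≤ Module.finrank ℂ (weightSpace R μ) :=
      Submodule.finrank_le _
    have h2 : Module.finrank ℂ (LinearMap.ker q) ≤ Module.finrank ℂ (weightSpace S μ) := by
      have hker : ((LinearMap.ker q).map (weightSpace T μ).subtype) ≤ (weightSpace S μ).map i := by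
        rintro _ ⟨v, hv, rfl⟩
        have hv0 : p v = 0 := by
          have := congrArg Subtype.val (LinearMap.mem_ker.mp hv)
          simpa [q] using this
        have hv1 : (v : V) ∈ LinearMap.range i := by rw [hip]; exact hv0
        obtain ⟨w, hw⟩ := hv1
        refine ⟨w, ?_, hw⟩
        rw [SetLike.mem_coe, mem_weightSpace]
        intro a
        obtain ⟨k, hk⟩ := (mem_weightSpace _ _ _).mp v.2 a
        refine ⟨k, hi ?_⟩
        rw [intertwine_pow (hiS a), hw, hk, map_zero]
      have := Submodule.finrank_mono hker
      rwa [← (Submodule.equivMapOfInjective i hi _).finrank_eq,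
        ← (Submodule.equivMapOfInjective _ (Submodule.subtype_injective _) _).finrank_eq] at this
    omega
  · rw [map_add, total_character, total_character, total_character]
    have h1 := LinearMap.finrank_range_add_finrank_ker p
    rw [← hip, LinearMap.range_eq_top.mpr hp, finrank_top, LinearMap.finrank_range_of_inj hi] at h1
    omega

theorem sum_finrank_le [FiniteDimensional ℂ V] {X : Type*} {U : X → Submodule ℂ V}
    (hU : iSupIndep U) (F : Finset X) (P : Submodule ℂ V) (hF : ∀ μ ∈ F, U μ ≤ P) :
    ∑ μ ∈ F, Module.finrank ℂ (U μ) ≤ Module.finrank ℂ P := by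
  classical
  have hind : iSupIndep fun μ : F => U μ := hU.comp Subtype.val_injective
  have hinj := hind.dfinsupp_lsum_injective
  rw [← Finset.sum_coe_sort F (fun μ => Module.finrank ℂ (U μ))]
  have h1 := Module.finrank_directSum (R := ℂ) (fun μ : F => U μ)
  rw [← h1]
  have h2 : LinearMap.range (DirectSum.coeLinearMap fun μ : F => U μ) ≤ P := by
    rw [DirectSum.range_coeLinearMap]
    exact iSup_le fun μ => hF μ μ.2
  rw [← LinearMap.finrank_range_of_inj
    (show Function.Injective (DirectSum.coeLinearMap fun μ : F => U μ) from hinj)]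
  exact Submodule.finrank_mono h2

theorem total_mapDomain {X Y : Type*} (f : X → Y) (x : X →₀ ℤ) :
    total (x.mapDomain f) = total x := by
  simp only [total, Finsupp.liftAddHom_apply]
  exact Finsupp.sum_mapDomain_index (by simp) (by simp)

theorem character_comp [FiniteDimensional ℂ V] (T : t →ₗ[ℂ] Module.End ℂ V)
    (hT : ∀ a b, Commute (T a) (T b)) (π : t' →ₗ[ℂ] t)
    (hT' : ∀ a b, Commute ((T ∘ₗ π) a) ((T ∘ₗ π) b)) :
    character (T ∘ₗ π) hT' = (character T hT).mapDomain π.dualMap := by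
  classical
  apply AddMonoidAlgebra.coeff_injective
  symm
  apply eq_of_le_of_total
  · intro ν
    have h1 : ((character T hT).mapDomain π.dualMap).coeff ν =
        ∑ μ ∈ (character T hT).coeff.support with π.dualMap μ = ν,
          (Module.finrank ℂ (weightSpace T μ) : ℤ) := by
      change (Finsupp.mapDomain π.dualMap (character T hT).coeff) ν = _
      rw [Finsupp.mapDomain, Finsupp.sum, Finsupp.finsetSum_apply, Finset.sum_filter]
      refine Finset.sum_congr rfl fun μ _ => ?_
      rw [Finsupp.single_apply, character_apply]
    rw [h1, character_apply]
    norm_cast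
    refine sum_finrank_le (weightSpace_indep T hT) _ _ fun μ hμ => ?_
    rw [Finset.mem_filter] at hμ
    intro v hv
    rw [mem_weightSpace] at hv ⊢
    intro a
    obtain ⟨k, hk⟩ := hv (π a)
    refine ⟨k, ?_⟩
    rw [← hμ.2]
    exact hk
  · change _ ≤ total (Finsupp.mapDomain π.dualMap (character T hT).coeff)
    rw [total_mapDomain, total_character, total_character]

/-- Restriction of functions along a linear map `π : t' → t`: the ring homomorphism
`e^μ ↦ e^(μ ∘ π)`. -/
def pullback (π : t' →ₗ[ℂ] t) :
    AddMonoidAlgebra ℤ (Module.Dual ℂ t) →+* AddMonoidAlgebra ℤ (Module.Dual ℂ t') :=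
  AddMonoidAlgebra.mapDomainRingHom ℤ π.dualMap.toAddMonoidHom

theorem pullback_character [FiniteDimensional ℂ V] (T : t →ₗ[ℂ] Module.End ℂ V)
    (hT : ∀ a b, Commute (T a) (T b)) (π : t' →ₗ[ℂ] t)
    (hT' : ∀ a b, Commute ((T ∘ₗ π) a) ((T ∘ₗ π) b)) :
    pullback π (character T hT) = character (T ∘ₗ π) hT' :=
  (character_comp T hT π hT').symm

theorem pullback_injective (π : t' →ₗ[ℂ] t) (hπ : Function.Surjective π) :
    Function.Injective (pullback π) :=
  AddMonoidAlgebra.mapDomain_injective (LinearMap.dualMap_injective_of_surjective hπ)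

/-- The action of `t` on an invariant subspace. -/
def subRep (T : t →ₗ[ℂ] Module.End ℂ V) (P : Submodule ℂ V) (hP : ∀ a, ∀ v ∈ P, T a v ∈ P) :
    t →ₗ[ℂ] Module.End ℂ P where
  toFun a := (T a).restrict (hP a)
  map_add' a b := by ext v; simp
  map_smul' c a := by ext v; simp

theorem subRep_comm (T : t →ₗ[ℂ] Module.End ℂ V) (hT : ∀ a b, Commute (T a) (T b))
    (P : Submodule ℂ V) (hP : ∀ a, ∀ v ∈ P, T a v ∈ P) (a b : t) :
    Commute (subRep T P hP a) (subRep T P hP b) := by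
  ext v
  exact congrArg (fun S : Module.End ℂ V => S v) (hT a b)

theorem character_homology [FiniteDimensional ℂ V] [FiniteDimensional ℂ W]
    (T : t →ₗ[ℂ] Module.End ℂ V) (S : t →ₗ[ℂ] Module.End ℂ W)
    (hT : ∀ a b, Commute (T a) (T b)) (hS : ∀ a b, Commute (S a) (S b))
    (d : V →ₗ[ℂ] W) (e : W →ₗ[ℂ] V) (hd : ∀ a v, d (T a v) = S a (d v))
    (he : ∀ a w, e (S a w) = T a (e w)) (hde : ∀ w, d (e w) = 0) (hed : ∀ v, e (d v) = 0)
    (R : t →ₗ[ℂ] Module.End ℂ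
      (LinearMap.ker d ⧸ (LinearMap.range e).submoduleOf (LinearMap.ker d)))
    (R' : t →ₗ[ℂ] Module.End ℂ
      (LinearMap.ker e ⧸ (LinearMap.range d).submoduleOf (LinearMap.ker e)))
    (hR : ∀ a b, Commute (R a) (R b)) (hR' : ∀ a b, Commute (R' a) (R' b))
    (hRT : ∀ a (v w : LinearMap.ker d), T a v = w →
      R a (Submodule.Quotient.mk v) = Submodule.Quotient.mk w)
    (hRS : ∀ a (v w : LinearMap.ker e), S a v = w →
      R' a (Submodule.Quotient.mk v) = Submodule.Quotient.mk w) :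
    character T hT - character S hS = character R hR - character R' hR' := by
  have kd : ∀ a, ∀ v ∈ LinearMap.ker d, T a v ∈ LinearMap.ker d := fun a v hv => by
    rw [LinearMap.mem_ker, hd, LinearMap.mem_ker.mp hv, map_zero]
  have ke : ∀ a, ∀ v ∈ LinearMap.ker e, S a v ∈ LinearMap.ker e := fun a v hv => by
    rw [LinearMap.mem_ker, he, LinearMap.mem_ker.mp hv, map_zero]
  have rd : ∀ a, ∀ v ∈ LinearMap.range d, S a v ∈ LinearMap.range d := by
    rintro a _ ⟨v, rfl⟩
    exact ⟨T a v, hd a v⟩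
  have re : ∀ a, ∀ v ∈ LinearMap.range e, T a v ∈ LinearMap.range e := by
    rintro a _ ⟨v, rfl⟩
    exact ⟨S a v, he a v⟩
  have h1 := character_exact (subRep_comm T hT _ kd) hT (subRep_comm S hS _ rd)
    (LinearMap.ker d).subtype d.rangeRestrict (Submodule.subtype_injective _)
    d.surjective_rangeRestrict (by simp) (fun _ _ => rfl)
    (fun a v => Subtype.ext (hd a v))
  have h2 := character_exact (subRep_comm S hS _ ke) hS (subRep_comm T hT _ re)
    (LinearMap.ker e).subtype e.rangeRestrict (Submodule.subtype_injective _)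
    e.surjective_rangeRestrict (by simp) (fun _ _ => rfl)
    (fun a v => Subtype.ext (he a v))
  have le1 : LinearMap.range e ≤ LinearMap.ker d := by
    rintro _ ⟨w, rfl⟩
    exact hde w
  have le2 : LinearMap.range d ≤ LinearMap.ker e := by
    rintro _ ⟨w, rfl⟩
    exact hed w
  have h3 := character_exact (subRep_comm T hT _ re) (subRep_comm T hT _ kd) hR
    (Submodule.inclusion le1) (Submodule.mkQ _) (Submodule.inclusion_injective le1)
    (Submodule.mkQ_surjective _)
    (by rw [Submodule.ker_mkQ, Submodule.range_inclusion]; rfl)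
    (fun _ _ => rfl) (fun a v => (hRT a v _ rfl).symm)
  have h4 := character_exact (subRep_comm S hS _ rd) (subRep_comm S hS _ ke) hR'
    (Submodule.inclusion le2) (Submodule.mkQ _) (Submodule.inclusion_injective le2)
    (Submodule.mkQ_surjective _)
    (by rw [Submodule.ker_mkQ, Submodule.range_inclusion]; rfl)
    (fun _ _ => rfl) (fun a v => (hRS a v _ rfl).symm)
  rw [h1, h2, h3, h4]
  abel

end Weights

section Descent

variable {V W U : Type*} [AddCommGroup V] [Module ℂ V] [AddCommGroup W] [Module ℂ W]
  [AddCommGroup U] [Module ℂ U]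

/-- The bilinear map `P/p × Q/q → R/r` induced by a bilinear map `V × W → U`. -/
def bilinSubquot (f : V →ₗ[ℂ] W →ₗ[ℂ] U) (P p : Submodule ℂ V) (Q q : Submodule ℂ W)
    (R r : Submodule ℂ U) (h : ∀ v ∈ P, ∀ w ∈ Q, f v w ∈ R)
    (h1 : ∀ v ∈ P, v ∈ p → ∀ w ∈ Q, f v w ∈ r)
    (h2 : ∀ v ∈ P, ∀ w ∈ Q, w ∈ q → f v w ∈ r) :
    (P ⧸ p.submoduleOf P) →ₗ[ℂ] (Q ⧸ q.submoduleOf Q) →ₗ[ℂ] (R ⧸ r.submoduleOf R) :=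
  (p.submoduleOf P).liftQ
    { toFun := fun v => (q.submoduleOf Q).mapQ (r.submoduleOf R)
        ((f v).restrict fun w hw => h v v.2 w hw) fun w hw => h2 v v.2 w w.2 hw
      map_add' := fun v v' => Submodule.linearMap_qext _ <| LinearMap.ext fun w =>
        congrArg (Submodule.Quotient.mk (p := r.submoduleOf R)) <| Subtype.ext <| by
          change f (v + v' : V) w = f v w + f v' w
          simp
      map_smul' := fun c v => Submodule.linearMap_qext _ <| LinearMap.ext fun w =>
        congrArg (Submodule.Quotient.mk (p := r.submoduleOf R)) <| Subtype.ext <| by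
          change f (c • v : V) w = c • f v w
          simp }
    (fun v hv => LinearMap.mem_ker.mpr <| Submodule.linearMap_qext _ <| LinearMap.ext fun w =>
      show Submodule.Quotient.mk (p := r.submoduleOf R) ⟨f v w, h v v.2 w w.2⟩ = 0 from
        (Submodule.Quotient.mk_eq_zero _).mpr (h1 v v.2 hv w w.2))

end Descent

/-- A complex Lie superalgebra `𝔤 = 𝔤₀ ⊕ 𝔤₁`: a Lie algebra `𝔤₀`, a `𝔤₀`-module `𝔤₁`
(`rep a x = [a, x]`), and the symmetric bracket `sq x y = [x, y]` of odd elements, subject to the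
super Jacobi identity. -/
structure LieSuperalgebra : Type (u + 1) where
  even : Type u
  odd : Type u
  [lieRing : LieRing even]
  [lieAlgebra : LieAlgebra ℂ even]
  [addCommGroup : AddCommGroup odd]
  [module : Module ℂ odd]
  rep : even →ₗ[ℂ] odd →ₗ[ℂ] odd
  sq : odd →ₗ[ℂ] odd →ₗ[ℂ] even
  rep_lie : ∀ a b x, rep ⁅a, b⁆ x = rep a (rep b x) - rep b (rep a x)
  sq_comm : ∀ x y, sq x y = sq y x
  lie_sq : ∀ a x y, ⁅a, sq x y⁆ = sq (rep a x) y + sq x (rep a y)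
  jacobi : ∀ x y z, rep (sq x y) z + rep (sq y z) x + rep (sq z x) y = 0

attribute [instance] LieSuperalgebra.lieRing LieSuperalgebra.lieAlgebra
  LieSuperalgebra.addCommGroup LieSuperalgebra.module

/-- A Lie superalgebra `𝔤` with a distinguished commutative subspace `𝔥 ⊆ 𝔤₀` (its Cartan
subalgebra), with respect to which weights are taken. -/
structure CartanPair : Type (u + 1) extends LieSuperalgebra.{u} where
  cartan : Submodule ℂ even
  cartan_comm : ∀ a ∈ cartan, ∀ b ∈ cartan, ⁅a, b⁆ = 0

/-- A finite-dimensional module `M = M₀ ⊕ M₁` over a Lie superalgebra. -/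
structure SuperModule (g : LieSuperalgebra.{u}) : Type (max u 1) where
  even : Type
  odd : Type
  [evenGroup : AddCommGroup even]
  [evenModule : Module ℂ even]
  [evenFinite : FiniteDimensional ℂ even]
  [oddGroup : AddCommGroup odd]
  [oddModule : Module ℂ odd]
  [oddFinite : FiniteDimensional ℂ odd]
  rep₀ : g.even →ₗ[ℂ] even →ₗ[ℂ] even
  rep₁ : g.even →ₗ[ℂ] odd →ₗ[ℂ] odd
  act₀ : g.odd →ₗ[ℂ] even →ₗ[ℂ] odd
  act₁ : g.odd →ₗ[ℂ] odd →ₗ[ℂ] even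
  rep₀_lie : ∀ a b m, rep₀ ⁅a, b⁆ m = rep₀ a (rep₀ b m) - rep₀ b (rep₀ a m)
  rep₁_lie : ∀ a b m, rep₁ ⁅a, b⁆ m = rep₁ a (rep₁ b m) - rep₁ b (rep₁ a m)
  act₀_rep : ∀ a x m, act₀ (g.rep a x) m = rep₁ a (act₀ x m) - act₀ x (rep₀ a m)
  act₁_rep : ∀ a x m, act₁ (g.rep a x) m = rep₀ a (act₁ x m) - act₁ x (rep₁ a m)
  rep₀_sq : ∀ x y m, rep₀ (g.sq x y) m = act₁ x (act₀ y m) + act₁ y (act₀ x m)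
  rep₁_sq : ∀ x y m, rep₁ (g.sq x y) m = act₀ x (act₁ y m) + act₀ y (act₁ x m)

attribute [instance] SuperModule.evenGroup SuperModule.evenModule SuperModule.evenFinite
  SuperModule.oddGroup SuperModule.oddModule SuperModule.oddFinite

namespace LieSuperalgebra

variable (g : LieSuperalgebra.{u}) (x : g.odd)

/-- The even part of the centraliser `𝔤^x`. -/
def evenCentralizer : LieSubalgebra ℂ g.even where
  __ := LinearMap.ker (g.rep.flip x)
  lie_mem' := by
    intro a b ha hb
    change g.rep a x = 0 at ha
    change g.rep b x = 0 at hb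
    change g.rep ⁅a, b⁆ x = 0
    simp [g.rep_lie, ha, hb]

theorem mem_evenCentralizer {a : g.even} : a ∈ g.evenCentralizer x ↔ g.rep a x = 0 := Iff.rfl

/-- The odd part of the centraliser `𝔤^x`. -/
def oddCentralizer : Submodule ℂ g.odd := LinearMap.ker (g.sq x)

theorem mem_oddCentralizer {v : g.odd} : v ∈ g.oddCentralizer x ↔ g.sq x v = 0 := Iff.rfl

/-- The odd part `[x, 𝔤₀]` of `[x, 𝔤]`. -/
def oddBoundary : Submodule ℂ g.odd := LinearMap.range (g.rep.flip x)

theorem mem_oddBoundary {v : g.odd} : v ∈ g.oddBoundary x ↔ ∃ c, g.rep c x = v := Iff.rfl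

/-- The even part `[x, 𝔤₁]` of `[x, 𝔤]`, as an ideal of the even part of `𝔤^x`. -/
def evenBoundary : LieIdeal ℂ (g.evenCentralizer x) where
  __ := (LinearMap.range (g.sq x)).submoduleOf (g.evenCentralizer x).toSubmodule
  lie_mem := by
    rintro ⟨b, hb⟩ ⟨a, ha⟩ ⟨v, hv⟩
    change g.sq x v = a at hv
    refine ⟨g.rep b v, ?_⟩
    change g.sq x (g.rep b v) = ⁅b, a⁆
    rw [← hv, g.lie_sq, (g.mem_evenCentralizer x).mp hb]
    simp

theorem mem_evenBoundary {a : g.evenCentralizer x} :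
    a ∈ g.evenBoundary x ↔ ∃ v, g.sq x v = a := Iff.rfl

theorem jacobi' (u v w : g.odd) : g.rep (g.sq u v) w = -g.rep (g.sq v w) u - g.rep (g.sq w u) v := by
  have := g.jacobi u v w
  rw [sub_eq_add_neg, eq_comm, neg_add_eq_iff_eq_add, eq_comm]
  rw [← sub_eq_zero, ← this]
  abel

/-- The Lie superalgebra `𝔤_x = 𝔤^x / [x, 𝔤]`, for an odd `x` with `[x, x] = 0`. -/
def ds (_hx : g.sq x x = 0) : LieSuperalgebra.{u} where
  even := g.evenCentralizer x ⧸ g.evenBoundary x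
  odd := g.oddCentralizer x ⧸ (g.oddBoundary x).submoduleOf (g.oddCentralizer x)
  rep := bilinSubquot g.rep (g.evenCentralizer x).toSubmodule
        (LinearMap.range (g.sq x)) (g.oddCentralizer x) (g.oddBoundary x) (g.oddCentralizer x)
        (g.oddBoundary x)
        (by
          intro a ha v hv
          have h := g.lie_sq a x v
          rw [(g.mem_oddCentralizer x).mp hv, (g.mem_evenCentralizer x).mp ha] at h
          simpa [mem_oddCentralizer] using h.symm)
        (by
          rintro _ ha ⟨u, rfl⟩ v hv
          refine ⟨-g.sq u v, ?_⟩
          have := g.jacobi' x u v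
          rw [g.sq_comm v x, (g.mem_oddCentralizer x).mp hv] at this
          simpa using this.symm)
        (by
          rintro a ha _ hv ⟨c, rfl⟩
          refine ⟨⁅a, c⁆, ?_⟩
          have := g.rep_lie a c x
          rw [(g.mem_evenCentralizer x).mp ha] at this
          simpa using this)
  rep_lie := by
    intro a b v
    induction a using Quotient.inductionOn' with | _ a
    induction b using Quotient.inductionOn' with | _ b
    induction v using Quotient.inductionOn' with | _ v
    exact congrArg (Submodule.Quotient.mk (p := (g.oddBoundary x).submoduleOf _))
      (Subtype.ext (g.rep_lie a b v))
  sq := bilinSubquot g.sq (g.oddCentralizer x) (g.oddBoundary x) (g.oddCentralizer x)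
        (g.oddBoundary x) (g.evenCentralizer x).toSubmodule (LinearMap.range (g.sq x))
        (by
          intro v hv w hw
          change g.rep (g.sq v w) x = 0
          rw [g.jacobi', g.sq_comm w x, (g.mem_oddCentralizer x).mp hv,
            (g.mem_oddCentralizer x).mp hw]
          simp)
        (by
          rintro _ hv ⟨c, rfl⟩ w hw
          refine ⟨-g.rep c w, ?_⟩
          have := g.lie_sq c x w
          rw [(g.mem_oddCentralizer x).mp hw] at this
          simp only [lie_zero] at this
          rw [map_neg]
          exact (eq_neg_of_add_eq_zero_left this.symm).symm)
        (by
          rintro v hv _ hw ⟨c, rfl⟩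
          refine ⟨-g.rep c v, ?_⟩
          have := g.lie_sq c x v
          rw [(g.mem_oddCentralizer x).mp hv] at this
          simp only [lie_zero] at this
          rw [map_neg, g.sq_comm v]
          exact (eq_neg_of_add_eq_zero_left this.symm).symm)
  sq_comm := by
    intro v w
    induction v using Quotient.inductionOn' with | _ v
    induction w using Quotient.inductionOn' with | _ w
    exact congrArg (Submodule.Quotient.mk (p := (g.evenBoundary x).toSubmodule))
      (Subtype.ext (g.sq_comm v w))
  lie_sq := by
    intro a v w
    induction a using Quotient.inductionOn' with | _ a
    induction v using Quotient.inductionOn' with | _ v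
    induction w using Quotient.inductionOn' with | _ w
    exact congrArg (Submodule.Quotient.mk (p := (g.evenBoundary x).toSubmodule))
      (Subtype.ext (g.lie_sq a v w))
  jacobi := by
    intro u v w
    induction u using Quotient.inductionOn' with | _ u
    induction v using Quotient.inductionOn' with | _ v
    induction w using Quotient.inductionOn' with | _ w
    exact congrArg (Submodule.Quotient.mk (p := (g.oddBoundary x).submoduleOf _))
      (Subtype.ext (g.jacobi u v w))

end LieSuperalgebra


namespace SuperModule

variable {g : LieSuperalgebra.{u}} (M : SuperModule g) (x : g.odd)

theorem act₁_act₀ (hx : g.sq x x = 0) (m : M.even) : M.act₁ x (M.act₀ x m) = 0 := by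
  have h := M.rep₀_sq x x m
  rw [hx, map_zero, LinearMap.zero_apply, ← two_smul ℂ] at h
  exact (smul_eq_zero.mp h.symm).resolve_left two_ne_zero

theorem act₀_act₁ (hx : g.sq x x = 0) (m : M.odd) : M.act₀ x (M.act₁ x m) = 0 := by
  have h := M.rep₁_sq x x m
  rw [hx, map_zero, LinearMap.zero_apply, ← two_smul ℂ] at h
  exact (smul_eq_zero.mp h.symm).resolve_left two_ne_zero

/-- The `𝔤_x`-module `M_x = Ker_M x / x M`. -/
def ds (hx : g.sq x x = 0) : SuperModule (g.ds x hx) where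
  even := LinearMap.ker (M.act₀ x) ⧸ (LinearMap.range (M.act₁ x)).submoduleOf _
  odd := LinearMap.ker (M.act₁ x) ⧸ (LinearMap.range (M.act₀ x)).submoduleOf _
  rep₀ := bilinSubquot M.rep₀ (g.evenCentralizer x).toSubmodule (LinearMap.range (g.sq x))
    (LinearMap.ker (M.act₀ x)) (LinearMap.range (M.act₁ x))
    (LinearMap.ker (M.act₀ x)) (LinearMap.range (M.act₁ x))
    (by
      intro a ha m hm
      have h := M.act₀_rep a x m
      rw [(g.mem_evenCentralizer x).mp ha, LinearMap.mem_ker.mp hm] at h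
      simpa using h)
    (by
      rintro _ ha ⟨u, rfl⟩ m hm
      refine ⟨M.act₀ u m, ?_⟩
      rw [M.rep₀_sq, LinearMap.mem_ker.mp hm, map_zero, add_zero])
    (by
      rintro a ha _ hm ⟨n, rfl⟩
      refine ⟨M.rep₁ a n, ?_⟩
      have h := M.act₁_rep a x n
      rw [(g.mem_evenCentralizer x).mp ha, map_zero, LinearMap.zero_apply] at h
      exact (sub_eq_zero.mp h.symm).symm)
  rep₁ := bilinSubquot M.rep₁ (g.evenCentralizer x).toSubmodule (LinearMap.range (g.sq x))
    (LinearMap.ker (M.act₁ x)) (LinearMap.range (M.act₀ x))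
    (LinearMap.ker (M.act₁ x)) (LinearMap.range (M.act₀ x))
    (by
      intro a ha m hm
      have h := M.act₁_rep a x m
      rw [(g.mem_evenCentralizer x).mp ha, LinearMap.mem_ker.mp hm] at h
      simpa using h)
    (by
      rintro _ ha ⟨u, rfl⟩ m hm
      refine ⟨M.act₁ u m, ?_⟩
      rw [M.rep₁_sq, LinearMap.mem_ker.mp hm, map_zero, add_zero])
    (by
      rintro a ha _ hm ⟨n, rfl⟩
      refine ⟨M.rep₀ a n, ?_⟩
      have h := M.act₀_rep a x n
      rw [(g.mem_evenCentralizer x).mp ha, map_zero, LinearMap.zero_apply] at h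
      exact (sub_eq_zero.mp h.symm).symm)
  act₀ := bilinSubquot M.act₀ (g.oddCentralizer x) (g.oddBoundary x)
    (LinearMap.ker (M.act₀ x)) (LinearMap.range (M.act₁ x))
    (LinearMap.ker (M.act₁ x)) (LinearMap.range (M.act₀ x))
    (by
      intro v hv m hm
      have h := M.rep₀_sq x v m
      rw [(g.mem_oddCentralizer x).mp hv, LinearMap.mem_ker.mp hm] at h
      simpa using h.symm)
    (by
      rintro _ hv ⟨c, rfl⟩ m hm
      refine ⟨-M.rep₀ c m, ?_⟩
      have h := M.act₀_rep c x m
      rw [LinearMap.mem_ker.mp hm, map_zero, zero_sub] at h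
      rw [map_neg]
      exact h.symm)
    (by
      rintro v hv _ hm ⟨n, rfl⟩
      refine ⟨-M.act₁ v n, ?_⟩
      have h := M.rep₁_sq x v n
      rw [(g.mem_oddCentralizer x).mp hv, map_zero, LinearMap.zero_apply] at h
      rw [map_neg]
      exact neg_eq_of_add_eq_zero_right h.symm)
  act₁ := bilinSubquot M.act₁ (g.oddCentralizer x) (g.oddBoundary x)
    (LinearMap.ker (M.act₁ x)) (LinearMap.range (M.act₀ x))
    (LinearMap.ker (M.act₀ x)) (LinearMap.range (M.act₁ x))
    (by
      intro v hv m hm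
      have h := M.rep₁_sq x v m
      rw [(g.mem_oddCentralizer x).mp hv, LinearMap.mem_ker.mp hm] at h
      simpa using h.symm)
    (by
      rintro _ hv ⟨c, rfl⟩ m hm
      refine ⟨-M.rep₁ c m, ?_⟩
      have h := M.act₁_rep c x m
      rw [LinearMap.mem_ker.mp hm, map_zero, zero_sub] at h
      rw [map_neg]
      exact h.symm)
    (by
      rintro v hv _ hm ⟨n, rfl⟩
      refine ⟨-M.act₀ v n, ?_⟩
      have h := M.rep₀_sq x v n
      rw [(g.mem_oddCentralizer x).mp hv, map_zero, LinearMap.zero_apply] at h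
      rw [map_neg]
      exact neg_eq_of_add_eq_zero_right h.symm)
  rep₀_lie := by
    intro a b m
    induction a using Quotient.inductionOn' with | _ a
    induction b using Quotient.inductionOn' with | _ b
    induction m using Quotient.inductionOn' with | _ m
    exact congrArg (Submodule.Quotient.mk (p := (LinearMap.range (M.act₁ x)).submoduleOf _))
      (Subtype.ext (M.rep₀_lie a b m))
  rep₁_lie := by
    intro a b m
    induction a using Quotient.inductionOn' with | _ a
    induction b using Quotient.inductionOn' with | _ b
    induction m using Quotient.inductionOn' with | _ m
    exact congrArg (Submodule.Quotient.mk (p := (LinearMap.range (M.act₀ x)).submoduleOf _))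
      (Subtype.ext (M.rep₁_lie a b m))
  act₀_rep := by
    intro a v m
    induction a using Quotient.inductionOn' with | _ a
    induction v using Quotient.inductionOn' with | _ v
    induction m using Quotient.inductionOn' with | _ m
    exact congrArg (Submodule.Quotient.mk (p := (LinearMap.range (M.act₀ x)).submoduleOf _))
      (Subtype.ext (M.act₀_rep a v m))
  act₁_rep := by
    intro a v m
    induction a using Quotient.inductionOn' with | _ a
    induction v using Quotient.inductionOn' with | _ v
    induction m using Quotient.inductionOn' with | _ m
    exact congrArg (Submodule.Quotient.mk (p := (LinearMap.range (M.act₁ x)).submoduleOf _))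
      (Subtype.ext (M.act₁_rep a v m))
  rep₀_sq := by
    intro v w m
    induction v using Quotient.inductionOn' with | _ v
    induction w using Quotient.inductionOn' with | _ w
    induction m using Quotient.inductionOn' with | _ m
    exact congrArg (Submodule.Quotient.mk (p := (LinearMap.range (M.act₁ x)).submoduleOf _))
      (Subtype.ext (M.rep₀_sq v w m))
  rep₁_sq := by
    intro v w m
    induction v using Quotient.inductionOn' with | _ v
    induction w using Quotient.inductionOn' with | _ w
    induction m using Quotient.inductionOn' with | _ m
    exact congrArg (Submodule.Quotient.mk (p := (LinearMap.range (M.act₀ x)).submoduleOf _))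
      (Subtype.ext (M.rep₁_sq v w m))

end SuperModule

namespace CartanPair

/-- The class in `𝔤_x` of an even element of `𝔤^x`. -/
def evenClass (g : CartanPair.{u}) (x : g.odd) (hx : g.sq x x = 0) (a : g.even)
    (ha : g.rep a x = 0) : (g.toLieSuperalgebra.ds x hx).even :=
  LieSubmodule.Quotient.mk (N := g.evenBoundary x) ⟨a, ha⟩

/-- The class in `𝔤_x` of an odd element of `𝔤^x`. -/
def oddClass (g : CartanPair.{u}) (x : g.odd) (hx : g.sq x x = 0) (v : g.odd)
    (hv : g.sq x v = 0) : (g.toLieSuperalgebra.ds x hx).odd :=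
  Submodule.Quotient.mk (p := (g.oddBoundary x).submoduleOf (g.oddCentralizer x)) ⟨v, hv⟩

/-- `𝔥 ∩ 𝔤^x`. -/
def cartanCentralizer (g : CartanPair.{u}) (x : g.odd) : Submodule ℂ (g.evenCentralizer x) :=
  g.cartan.submoduleOf (g.evenCentralizer x).toSubmodule

/-- `𝔤_x` with its distinguished subspace `𝔥_x`, the image of `𝔥 ∩ 𝔤^x`. -/
def ds (g : CartanPair.{u}) (x : g.odd) (hx : g.sq x x = 0) : CartanPair.{u} where
  toLieSuperalgebra := g.toLieSuperalgebra.ds x hx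
  cartan := (g.cartanCentralizer x).map (g.evenBoundary x).toSubmodule.mkQ
  cartan_comm := by
    rintro _ ⟨a, ha, rfl⟩ _ ⟨b, hb, rfl⟩
    have h : ⁅a, b⁆ = 0 := Subtype.ext (g.cartan_comm a ha b hb)
    change LieSubmodule.Quotient.mk (N := g.evenBoundary x) ⁅a, b⁆ = 0
    rw [h]
    rfl

variable {g : CartanPair.{u}}

theorem rep₀_comm (M : SuperModule g.toLieSuperalgebra) (a b : g.cartan) :
    Commute ((M.rep₀ ∘ₗ g.cartan.subtype) a : Module.End ℂ M.even)
      ((M.rep₀ ∘ₗ g.cartan.subtype) b) := by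
  ext m
  have h := M.rep₀_lie a b m
  rw [g.cartan_comm a a.2 b b.2, map_zero, LinearMap.zero_apply] at h
  exact sub_eq_zero.mp h.symm

theorem rep₁_comm (M : SuperModule g.toLieSuperalgebra) (a b : g.cartan) :
    Commute ((M.rep₁ ∘ₗ g.cartan.subtype) a : Module.End ℂ M.odd)
      ((M.rep₁ ∘ₗ g.cartan.subtype) b) := by
  ext m
  have h := M.rep₁_lie a b m
  rw [g.cartan_comm a a.2 b b.2, map_zero, LinearMap.zero_apply] at h
  exact sub_eq_zero.mp h.symm

/-- The supercharacter `sch M = ∑ (dim M₀^μ - dim M₁^μ) e^μ`, in the group ring of `𝔥^*`. -/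
def sch (M : SuperModule g.toLieSuperalgebra) : AddMonoidAlgebra ℤ (Module.Dual ℂ g.cartan) :=
  character (V := M.even) (M.rep₀ ∘ₗ g.cartan.subtype) (rep₀_comm M) -
    character (V := M.odd) (M.rep₁ ∘ₗ g.cartan.subtype) (rep₁_comm M)

variable (g) in
/-- The homomorphism `[M] ↦ sch M` from the free abelian group on the finite-dimensional
`𝔤`-modules. -/
def schHom : FreeAbelianGroup (SuperModule g.toLieSuperalgebra) →+
    AddMonoidAlgebra ℤ (Module.Dual ℂ g.cartan) :=
  FreeAbelianGroup.lift sch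

variable (g) in
/-- The supercharacter ring `J_𝔤`: the image of `sch` in `ℤ[𝔥^*]`, as an additive group. (It is
closed under products because tensor products of finite-dimensional modules exist.) -/
def J : AddSubgroup (AddMonoidAlgebra ℤ (Module.Dual ℂ g.cartan)) := (schHom g).range

/-- The class `[M] ∈ J_𝔤`. -/
def cls (M : SuperModule g.toLieSuperalgebra) : J g :=
  ⟨sch M, FreeAbelianGroup.of M, FreeAbelianGroup.lift_apply_of _ _⟩

section WellDefined

variable (x : g.odd) (hx : g.sq x x = 0)

/-- The inclusion `𝔥 ∩ 𝔤^x → 𝔥`. -/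
def toCartan : g.cartanCentralizer x →ₗ[ℂ] g.cartan where
  toFun a := ⟨a.1.1, a.2⟩
  map_add' _ _ := rfl
  map_smul' _ _ := rfl

/-- The projection `𝔥 ∩ 𝔤^x → 𝔥_x`. -/
def toCartanDS : g.cartanCentralizer x →ₗ[ℂ] (g.ds x hx).cartan where
  toFun a := ⟨(g.evenBoundary x).toSubmodule.mkQ a, a.1, a.2, rfl⟩
  map_add' _ _ := rfl
  map_smul' _ _ := rfl

theorem toCartanDS_surjective : Function.Surjective (toCartanDS x hx) := by
  rintro ⟨_, a, ha, rfl⟩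
  exact ⟨⟨a, ha⟩, rfl⟩

theorem pullback_sch (M : SuperModule g.toLieSuperalgebra) :
    pullback (toCartan x) (sch M) = pullback (toCartanDS x hx) (sch (g := g.ds x hx) (M.ds x hx)) := by
  have c1 := fun a b => rep₀_comm M (toCartan x a) (toCartan x b)
  have c2 := fun a b => rep₁_comm M (toCartan x a) (toCartan x b)
  have c3 := fun a b => rep₀_comm (g := g.ds x hx) (M.ds x hx) (toCartanDS x hx a)
    (toCartanDS x hx b)
  have c4 := fun a b => rep₁_comm (g := g.ds x hx) (M.ds x hx) (toCartanDS x hx a)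
    (toCartanDS x hx b)
  unfold sch
  rw [map_sub, map_sub, pullback_character _ _ _ c1, pullback_character _ _ _ c2,
    pullback_character _ _ _ c3, pullback_character _ _ _ c4]
  refine character_homology _ _ c1 c2 (M.act₀ x) (M.act₁ x) ?_ ?_ (M.act₀_act₁ x hx)
    (M.act₁_act₀ x hx) _ _ c3 c4 ?_ ?_
  · intro a m
    have h := M.act₀_rep a.1.1 x m
    rw [(g.mem_evenCentralizer x).mp a.1.2, map_zero, LinearMap.zero_apply] at h
    exact (sub_eq_zero.mp h.symm).symm
  · intro a m
    have h := M.act₁_rep a.1.1 x m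
    rw [(g.mem_evenCentralizer x).mp a.1.2, map_zero, LinearMap.zero_apply] at h
    exact (sub_eq_zero.mp h.symm).symm
  · intro a v w h
    exact congrArg Submodule.Quotient.mk (Subtype.ext h)
  · intro a v w h
    exact congrArg Submodule.Quotient.mk (Subtype.ext h)

/-- `[M] ↦ [DS_x M]`, on the free abelian group on the finite-dimensional `𝔤`-modules. -/
def dsFree : FreeAbelianGroup (SuperModule g.toLieSuperalgebra) →+ J (g.ds x hx) :=
  FreeAbelianGroup.lift fun M => cls (g := g.ds x hx) (M.ds x hx)

theorem pullback_schHom (m : FreeAbelianGroup (SuperModule g.toLieSuperalgebra)) :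
    pullback (toCartan x) (schHom g m) = pullback (toCartanDS x hx) (dsFree x hx m : _) := by
  induction m using FreeAbelianGroup.induction_on with
  | zero => simp
  | of M => simpa [schHom, dsFree, cls] using pullback_sch x hx M
  | neg M ih => simpa using ih
  | add a b ha hb => simp [ha, hb]

theorem ker_le : (schHom g).rangeRestrict.ker ≤ (dsFree x hx).ker := by
  intro m hm
  have h0 : schHom g m = 0 := congrArg Subtype.val (AddMonoidHom.mem_ker.mp hm)
  have h := pullback_schHom x hx m
  rw [h0, map_zero] at h
  rw [AddMonoidHom.mem_ker]
  apply Subtype.ext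
  apply pullback_injective _ (toCartanDS_surjective x hx)
  rw [← h]
  simp

/-- The homomorphism `ds_x : J_𝔤 → J_{𝔤_x}` determined by `[M] ↦ [DS_x M]` and extended
linearly; well-definedness is `ker_le`. -/
def dsHom : J g →+ J (g.ds x hx) :=
  (schHom g).rangeRestrict.liftOfSurjective (schHom g).rangeRestrict_surjective
    ⟨dsFree x hx, ker_le x hx⟩

theorem dsHom_cls (M : SuperModule g.toLieSuperalgebra) :
    dsHom x hx (cls M) = cls (g := g.ds x hx) (M.ds x hx) := by
  have h1 : cls M = (schHom g).rangeRestrict (FreeAbelianGroup.of M) :=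
    Subtype.ext (FreeAbelianGroup.lift_apply_of _ _).symm
  rw [h1, dsHom]
  have := AddMonoidHom.liftOfRightInverse_comp_apply (schHom g).rangeRestrict _
    (Function.rightInverse_surjInv (schHom g).rangeRestrict_surjective)
    ⟨dsFree x hx, ker_le x hx⟩ (FreeAbelianGroup.of M)
  exact this.trans (FreeAbelianGroup.lift_apply_of _ _)

end WellDefined

section Iterate

variable {k : ℕ}

theorem sq_sum (x : Fin k → g.odd) (hx : ∀ i j, g.sq (x i) (x j) = 0) :
    g.sq (∑ i, x i) (∑ i, x i) = 0 := by
  simp [map_sum, hx]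

theorem rep_sum (x : Fin k → g.odd) {a : g.even} (ha : ∀ i, g.rep a (x i) = 0) :
    g.rep a (∑ i, x i) = 0 := by
  simp [map_sum, ha]

theorem sq_sum_left (x : Fin k → g.odd) {v : g.odd} (hv : ∀ i, g.sq (x i) v = 0) :
    g.sq (∑ i, x i) v = 0 := by
  simp [map_sum, hv]

/-- For pairwise supercommuting odd `x₁, …, x_{k+1}`, the classes of `x₁, …, x_k` in
`𝔤_{x_{k+1}}`. -/
def descend (x : Fin (k + 1) → g.odd) (hx : ∀ i j, g.sq (x i) (x j) = 0) (i : Fin k) :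
    (g.ds (x (Fin.last k)) (hx _ _)).odd :=
  g.oddClass _ (hx _ _) (x i.castSucc) (hx _ _)

theorem descend_sq (x : Fin (k + 1) → g.odd) (hx : ∀ i j, g.sq (x i) (x j) = 0) (i j : Fin k) :
    (g.ds (x (Fin.last k)) (hx _ _)).sq (descend x hx i) (descend x hx j) = 0 :=
  congrArg (Submodule.Quotient.mk (p := (g.evenBoundary _).toSubmodule))
    (Subtype.ext (hx i.castSucc j.castSucc) :
      (⟨g.sq (x i.castSucc) (x j.castSucc), _⟩ : g.evenCentralizer (x (Fin.last k))) = 0)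

theorem descend_rep (x : Fin (k + 1) → g.odd) (hx : ∀ i j, g.sq (x i) (x j) = 0) (a : g.even)
    (ha : ∀ i, g.rep a (x i) = 0) (i : Fin k) :
    (g.ds (x (Fin.last k)) (hx _ _)).rep (g.evenClass _ (hx _ _) a (ha _)) (descend x hx i) = 0 :=
  congrArg (Submodule.Quotient.mk (p := (g.oddBoundary _).submoduleOf _))
    (Subtype.ext (ha i.castSucc) :
      (⟨g.rep a (x i.castSucc), _⟩ : g.oddCentralizer (x (Fin.last k))) = 0)

theorem descend_sq_left (x : Fin (k + 1) → g.odd) (hx : ∀ i j, g.sq (x i) (x j) = 0) (v : g.odd)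
    (hv : ∀ i, g.sq (x i) v = 0) (i : Fin k) :
    (g.ds (x (Fin.last k)) (hx _ _)).sq (descend x hx i) (g.oddClass _ (hx _ _) v (hv _)) = 0 :=
  congrArg (Submodule.Quotient.mk (p := (g.evenBoundary _).toSubmodule))
    (Subtype.ext (hv i.castSucc) :
      (⟨g.sq (x i.castSucc) v, _⟩ : g.evenCentralizer (x (Fin.last k))) = 0)

/-- The iterated algebra `(⋯((𝔤_{x_k})_{x_{k-1}})⋯)_{x₁}`. -/
def iter : (k : ℕ) → (g : CartanPair.{u}) → (x : Fin k → g.odd) →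
    (∀ i j, g.sq (x i) (x j) = 0) → CartanPair.{u}
  | 0, g, _, _ => g
  | k + 1, g, x, hx => iter k (g.ds (x (Fin.last k)) (hx _ _)) (descend x hx) (descend_sq x hx)

/-- The class in the iterated algebra of an even element commuting with all `x_i`. -/
def iterEven : (k : ℕ) → (g : CartanPair.{u}) → (x : Fin k → g.odd) →
    (hx : ∀ i j, g.sq (x i) (x j) = 0) → (a : g.even) → (∀ i, g.rep a (x i) = 0) →
    (iter k g x hx).even
  | 0, _, _, _, a, _ => a
  | k + 1, g, x, hx, a, ha => iterEven k (g.ds (x (Fin.last k)) (hx _ _)) (descend x hx)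
      (descend_sq x hx) (g.evenClass _ (hx _ _) a (ha _)) (descend_rep x hx a ha)

/-- The class in the iterated algebra of an odd element supercommuting with all `x_i`. -/
def iterOdd : (k : ℕ) → (g : CartanPair.{u}) → (x : Fin k → g.odd) →
    (hx : ∀ i j, g.sq (x i) (x j) = 0) → (v : g.odd) → (∀ i, g.sq (x i) v = 0) →
    (iter k g x hx).odd
  | 0, _, _, _, v, _ => v
  | k + 1, g, x, hx, v, hv => iterOdd k (g.ds (x (Fin.last k)) (hx _ _)) (descend x hx)
      (descend_sq x hx) (g.oddClass _ (hx _ _) v (hv _)) (descend_sq_left x hx v hv)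

/-- The composition `ds_{x₁} ∘ ⋯ ∘ ds_{x_k}`. -/
def dsComp : (k : ℕ) → (g : CartanPair.{u}) → (x : Fin k → g.odd) →
    (hx : ∀ i j, g.sq (x i) (x j) = 0) → J g →+ J (iter k g x hx)
  | 0, g, _, _ => AddMonoidHom.id (J g)
  | k + 1, g, x, hx => (dsComp k (g.ds (x (Fin.last k)) (hx _ _)) (descend x hx)
      (descend_sq x hx)).comp (dsHom (x (Fin.last k)) (hx _ _))

end Iterate

/-- An isomorphism of Lie superalgebras carrying the distinguished subspace `𝔥` onto `𝔥'`. -/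
structure Iso (g g' : CartanPair.{u}) where
  even : g.even ≃ₗ[ℂ] g'.even
  odd : g.odd ≃ₗ[ℂ] g'.odd
  map_lie : ∀ a b, even ⁅a, b⁆ = ⁅even a, even b⁆
  map_rep : ∀ a v, odd (g.rep a v) = g'.rep (even a) (odd v)
  map_sq : ∀ v w, even (g.sq v w) = g'.sq (odd v) (odd w)
  map_cartan : g.cartan.map (even : g.even →ₗ[ℂ] g'.even) = g'.cartan

/-- The induced isomorphism `𝔥 ≃ 𝔥'`. -/
def Iso.cartanEquiv {g g' : CartanPair.{u}} (Φ : Iso g g') : g.cartan ≃ₗ[ℂ] g'.cartan :=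
  Φ.even.ofSubmodules _ _ Φ.map_cartan

/-- The identification `ℤ[𝔥^*] → ℤ[𝔥'^*]`, `e^μ ↦ e^(μ ∘ φ⁻¹)`, where `φ : 𝔥 ≃ 𝔥'`. -/
def Iso.transport {g g' : CartanPair.{u}} (Φ : Iso g g') :
    AddMonoidAlgebra ℤ (Module.Dual ℂ g.cartan) →+*
      AddMonoidAlgebra ℤ (Module.Dual ℂ g'.cartan) :=
  pullback (Φ.cartanEquiv.symm : g'.cartan →ₗ[ℂ] g.cartan)

section Roots

variable (g)

/-- `{a ∈ 𝔤₀ | [h, a] = α(h) a for all h ∈ 𝔥}`. -/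
def evenRootSpace (α : Module.Dual ℂ g.cartan) : Submodule ℂ g.even where
  carrier := {a | ∀ h : g.cartan, ⁅(h : g.even), a⁆ = α h • a}
  zero_mem' := by simp
  add_mem' := by
    intro a b ha hb h
    rw [lie_add, ha h, hb h, smul_add]
  smul_mem' := by
    intro c a ha h
    rw [lie_smul, ha h, smul_comm]

/-- `{v ∈ 𝔤₁ | [h, v] = α(h) v for all h ∈ 𝔥}`. -/
def oddRootSpace (α : Module.Dual ℂ g.cartan) : Submodule ℂ g.odd where
  carrier := {v | ∀ h : g.cartan, g.rep h v = α h • v}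
  zero_mem' := by simp
  add_mem' := by
    intro a b ha hb h
    rw [map_add, ha h, hb h, smul_add]
  smul_mem' := by
    intro c a ha h
    rw [map_smul, ha h, smul_comm]

/-- `𝔤` is finite-dimensional with reductive even part (the adjoint representation of `𝔤₀` is
completely reducible), `𝔥` is a Cartan subalgebra, and there is a root space decomposition
`𝔤 = 𝔥 ⊕ ⨁_{α ≠ 0} 𝔤_α`. -/
structure IsReductivePair : Prop where
  finite_even : FiniteDimensional ℂ g.even
  finite_odd : FiniteDimensional ℂ g.odd
  reductive : ComplementedLattice (LieIdeal ℂ g.even)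
  even_zero : g.evenRootSpace 0 = g.cartan
  odd_zero : g.oddRootSpace 0 = ⊥
  iSup_even : ⨆ α, g.evenRootSpace α = ⊤
  iSup_odd : ⨆ α, g.oddRootSpace α = ⊤

/-- A nondegenerate even supersymmetric invariant bilinear form on `𝔤`. The two invariance
identities imply the remaining ones by (super)symmetry. -/
structure InvariantForm where
  even : LinearMap.BilinForm ℂ g.even
  odd : LinearMap.BilinForm ℂ g.odd
  even_symm : ∀ a b, even a b = even b a
  odd_skew : ∀ v w, odd v w = -odd w v
  even_invariant : ∀ a b c, even ⁅a, b⁆ c = even a ⁅b, c⁆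
  odd_invariant : ∀ a v w, odd (g.rep a v) w = even a (g.sq v w)
  even_nondegenerate : ∀ a, (∀ b, even a b = 0) → a = 0
  odd_nondegenerate : ∀ v, (∀ w, odd v w = 0) → v = 0

variable {g}

/-- `(α, β) = 0` for the form on `𝔥^*` induced by the form on `𝔥`: `(α, β) = β(t_α)`, where
`t_α ∈ 𝔥` represents `α`, that is `(t_α, h) = α(h)` for all `h ∈ 𝔥`. -/
def InvariantForm.Orthogonal (F : InvariantForm g) (α β : Module.Dual ℂ g.cartan) : Prop :=
  ∃ t : g.cartan, (∀ h : g.cartan, F.even t h = α h) ∧ β t = 0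

/-- `β` is an isotropic (odd) root. -/
structure InvariantForm.IsIsotropicRoot (F : InvariantForm g) (β : Module.Dual ℂ g.cartan) :
    Prop where
  ne_zero : β ≠ 0
  odd_root : g.oddRootSpace β ≠ ⊥
  isotropic : F.Orthogonal β β

/-- `{β₁, …, β_k} ∈ S_𝔤`: linearly independent, mutually orthogonal isotropic roots. -/
structure InvariantForm.IsIsotropicSystem (F : InvariantForm g) {k : ℕ}
    (β : Fin k → Module.Dual ℂ g.cartan) : Prop where
  root : ∀ i, F.IsIsotropicRoot (β i)
  orthogonal : ∀ i j, i ≠ j → F.Orthogonal (β i) (β j)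
  independent : LinearIndependent ℂ β

end Roots

end CartanPair

end DufloSerganova

end

/-!
Let `Dᵢ = ad xᵢ`. Suppose odd maps `sᵢ` satisfy `sᵢ Dⱼ + Dⱼ sᵢ = 0` for `i ≠ j`, and that
`1 = π + ∑ᵢ (Dᵢ sᵢ + sᵢ Dᵢ)` with `Dᵢ π = π Dᵢ = 0`. Then `1 = π + (D s + s D)` also holds for
`D = ∑ᵢ Dᵢ` and `s = ∑ᵢ sᵢ`, so that `𝔤_x` is `⋂ᵢ 𝔤^{xᵢ}` modulo the kernel of `π`; and the
`sᵢ` with `i < k` descend to the homology of `D_k`, so that, by induction on `k`, the iterated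
quotient `𝔤'` is `⋂ᵢ 𝔤^{xᵢ}` modulo the same kernel.

Such `sᵢ` exist because each `xᵢ ≠ 0` has an opposite root vector `yᵢ` with which it generates a
copy of `𝔰𝔩(1|1)`: the commuting operators `ad [xᵢ, yᵢ]` act on root spaces by scalars, and off
their joint kernel they can be inverted to give homotopies built from `ad yᵢ`. On the joint kernel
`Dᵢ` is nonzero only along `𝔥` and `yᵢ`, because a root orthogonal to `βᵢ`, other than `-βᵢ`, is no
longer a root once `βᵢ` is added; rank-one maps take care of those vectors.

A supercharacter and its image under `ds` agree on the Cartan elements that commute with the odd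
vector. Hence both sides of the last claim pull back to the restriction of `f` to
`𝔥 ∩ ⋂ᵢ 𝔤^{xᵢ}`, and pulling back along a surjection of Cartan subalgebras is injective.
-/

noncomputable section

namespace DufloSerganova

/-! ### Homology under commuting contractions -/

section Homology

variable {R V W V' W' V'' W'' : Type*} [Ring R] [AddCommGroup V] [Module R V] [AddCommGroup W]
  [Module R W] [AddCommGroup V'] [Module R V'] [AddCommGroup W'] [Module R W']
  [AddCommGroup V''] [Module R V''] [AddCommGroup W''] [Module R W'']

/-- The homology `ker d / im e` of `W → V → W`. Nothing is assumed about `d ∘ e`, so the image is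
intersected with the kernel. -/
abbrev Homology (d : V →ₗ[R] W) (e : W →ₗ[R] V) : Type _ :=
  LinearMap.ker d ⧸ (LinearMap.range e).submoduleOf (LinearMap.ker d)

/-- `f' : H(d, e) → H(d', e')` is the map induced by `f` on homology classes. -/
def Induces {d : V →ₗ[R] W} {e : W →ₗ[R] V} {d' : V' →ₗ[R] W'} {e' : W' →ₗ[R] V'}
    (f : V →ₗ[R] V') (f' : Homology d e →ₗ[R] Homology d' e') : Prop :=
  ∀ a : LinearMap.ker d, ∃ h : f a ∈ LinearMap.ker d',
    f' (Submodule.Quotient.mk a) = Submodule.Quotient.mk ⟨f a, h⟩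

variable {d : V →ₗ[R] W} {e : W →ₗ[R] V} {d' : V' →ₗ[R] W'} {e' : W' →ₗ[R] V'}
  {d'' : V'' →ₗ[R] W''} {e'' : W'' →ₗ[R] V''}

/-- The map on homology induced by `f`, where `f` preserves kernels and images. -/
def homologyMap (f : V →ₗ[R] V') (hker : ∀ a, d a = 0 → d' (f a) = 0)
    (hrange : ∀ w, f (e w) ∈ LinearMap.range e') : Homology d e →ₗ[R] Homology d' e' :=
  Submodule.mapQ _ _ (f.restrict hker) fun a ⟨w, hw⟩ =>
    show f a ∈ LinearMap.range e' from (show e w = a from hw) ▸ hrange w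

theorem induces_homologyMap (f : V →ₗ[R] V') (hker : ∀ a, d a = 0 → d' (f a) = 0)
    (hrange : ∀ w, f (e w) ∈ LinearMap.range e') :
    Induces f (homologyMap f hker hrange : Homology d e →ₗ[R] Homology d' e') :=
  fun a => ⟨hker a a.2, rfl⟩

namespace Induces

theorem id : Induces LinearMap.id (LinearMap.id : Homology d e →ₗ[R] Homology d e) :=
  fun a => ⟨a.2, rfl⟩

theorem zero : Induces 0 (0 : Homology d e →ₗ[R] Homology d' e') := fun _ => ⟨zero_mem _, rfl⟩

theorem comp {f : V →ₗ[R] V'} {f' : Homology d e →ₗ[R] Homology d' e'} {g : V' →ₗ[R] V''}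
    {g' : Homology d' e' →ₗ[R] Homology d'' e''} (hg : Induces g g') (hf : Induces f f') :
    Induces (g ∘ₗ f) (g' ∘ₗ f') := fun a =>
  have ⟨hfa, hfa'⟩ := hf a
  have ⟨hga, hga'⟩ := hg ⟨f a, hfa⟩
  ⟨hga, (congrArg g' hfa').trans hga'⟩

theorem add {f₁ f₂ : V →ₗ[R] V'} {f₁' f₂' : Homology d e →ₗ[R] Homology d' e'}
    (h₁ : Induces f₁ f₁') (h₂ : Induces f₂ f₂') : Induces (f₁ + f₂) (f₁' + f₂') := fun a =>
  have ⟨ha₁, ha₁'⟩ := h₁ a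
  have ⟨ha₂, ha₂'⟩ := h₂ a
  ⟨add_mem ha₁ ha₂, congrArg₂ (· + ·) ha₁' ha₂'⟩

theorem sum {ι : Type*} {s : Finset ι} {f : ι → V →ₗ[R] V'}
    {f' : ι → Homology d e →ₗ[R] Homology d' e'} (h : ∀ i ∈ s, Induces (f i) (f' i)) :
    Induces (∑ i ∈ s, f i) (∑ i ∈ s, f' i) := by
  classical
  induction s using Finset.induction_on with
  | empty => exact zero
  | insert i s hi ih =>
    rw [Finset.sum_insert hi, Finset.sum_insert hi]
    exact (h i (s.mem_insert_self i)).add (ih fun j hj => h j (Finset.mem_insert_of_mem hj))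

theorem eq_of_sub_mem_range {f₁ f₂ : V →ₗ[R] V'} {f₁' f₂' : Homology d e →ₗ[R] Homology d' e'}
    (h₁ : Induces f₁ f₁') (h₂ : Induces f₂ f₂')
    (h : ∀ a, d a = 0 → f₁ a - f₂ a ∈ LinearMap.range e') : f₁' = f₂' := by
  refine LinearMap.ext fun a => ?_
  induction a using Submodule.Quotient.induction_on with | _ a
  obtain ⟨_, ha₁⟩ := h₁ a
  obtain ⟨_, ha₂⟩ := h₂ a
  rw [ha₁, ha₂]
  exact (Submodule.Quotient.eq _).2 (h a a.2)

theorem eq {f : V →ₗ[R] V'} {f₁' f₂' : Homology d e →ₗ[R] Homology d' e'} (h₁ : Induces f f₁')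
    (h₂ : Induces f f₂') : f₁' = f₂' :=
  h₁.eq_of_sub_mem_range h₂ fun a _ => by rw [sub_self]; exact zero_mem _

end Induces

end Homology

section JointContraction

variable {R V W ι : Type*} [Ring R] [AddCommGroup V] [Module R V] [AddCommGroup W]
  [Module R W]

/-- Simultaneous homotopies for a family of two-periodic pairs `dᵢ : V → W`, `eᵢ : W → V`: the
identity is `π + ∑ᵢ (Dᵢ sᵢ + sᵢ Dᵢ)` for the odd operators `Dᵢ = (dᵢ, eᵢ)` and
`sᵢ = (homV i, homW i)` of `V ⊕ W`, where `Dᵢ π = π Dᵢ = 0` and `sᵢ` anticommutes with `Dⱼ` for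
`i ≠ j`. -/
structure JointContraction [Fintype ι] (d : ι → V →ₗ[R] W) (e : ι → W →ₗ[R] V) where
  projV : V →ₗ[R] V
  projW : W →ₗ[R] W
  homV : ι → V →ₗ[R] W
  homW : ι → W →ₗ[R] V
  d_comp_projV : ∀ i, d i ∘ₗ projV = 0
  e_comp_projW : ∀ i, e i ∘ₗ projW = 0
  projW_comp_d : ∀ i, projW ∘ₗ d i = 0
  projV_comp_e : ∀ i, projV ∘ₗ e i = 0
  homotopyV : LinearMap.id = projV + ∑ i, (e i ∘ₗ homV i + homW i ∘ₗ d i)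
  homotopyW : LinearMap.id = projW + ∑ i, (d i ∘ₗ homW i + homV i ∘ₗ e i)
  anticommV : ∀ i j, i ≠ j → e j ∘ₗ homV i + homW i ∘ₗ d j = 0
  anticommW : ∀ i j, i ≠ j → d j ∘ₗ homW i + homV i ∘ₗ e j = 0

namespace JointContraction

section

variable [Fintype ι] {d : ι → V →ₗ[R] W} {e : ι → W →ₗ[R] V} (c : JointContraction d e)

/-- The same homotopies with the roles of `V` and `W` exchanged. -/
def symm : JointContraction e d where
  projV := c.projW
  projW := c.projV
  homV := c.homW
  homW := c.homV
  d_comp_projV := c.e_comp_projW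
  e_comp_projW := c.d_comp_projV
  projW_comp_d := c.projV_comp_e
  projV_comp_e := c.projW_comp_d
  homotopyV := c.homotopyW
  homotopyW := c.homotopyV
  anticommV := c.anticommW
  anticommW := c.anticommV

theorem d_projV (i : ι) (a : V) : d i (c.projV a) = 0 := LinearMap.congr_fun (c.d_comp_projV i) a

theorem projV_e (i : ι) (v : W) : c.projV (e i v) = 0 := LinearMap.congr_fun (c.projV_comp_e i) v

theorem e_homV {i j : ι} (hij : i ≠ j) (a : V) : e j (c.homV i a) = -c.homW i (d j a) :=
  eq_neg_of_add_eq_zero_left (LinearMap.congr_fun (c.anticommV i j hij) a)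

theorem eq_projV_add_sum (a : V) :
    a = c.projV a + ∑ i, (e i (c.homV i a) + c.homW i (d i a)) := by
  simpa using LinearMap.congr_fun c.homotopyV a

theorem projV_projV {a : V} (ha : ∀ i, d i a = 0) : c.projV (c.projV a) = c.projV a := by
  have h := congrArg c.projV (c.eq_projV_add_sum a)
  simpa only [ha, map_zero, add_zero, map_add, map_sum, c.projV_e, Finset.sum_const_zero]
    using h.symm

theorem projV_mem_range_iff {a : V} (ha : ∀ i, d i a = 0) (i : ι) :
    c.projV a ∈ LinearMap.range (e i) ↔ c.projV a = 0 := by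
  refine ⟨fun ⟨v, hv⟩ => ?_, fun h => h ▸ zero_mem _⟩
  rw [← c.projV_projV ha, ← hv, c.projV_e]

/-- Since `sᵢ` anticommutes with `Dⱼ` for `i ≠ j`, replacing `∑ᵢ Dᵢ sᵢ` by `(∑ⱼ Dⱼ) ∑ᵢ sᵢ` changes
`sᵢ Dᵢ` into `sᵢ ∑ⱼ Dⱼ`. -/
theorem eq_projV_add_total (a : V) :
    a = c.projV a + ((∑ i, e i) (∑ i, c.homV i a) + ∑ i, c.homW i ((∑ i, d i) a)) := by
  classical
  have hterm (i : ι) : (∑ j, e j) (c.homV i a) + c.homW i ((∑ j, d j) a) =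
      e i (c.homV i a) + c.homW i (d i a) := by
    simp only [LinearMap.sum_apply, map_sum, ← Finset.sum_add_distrib]
    exact Finset.sum_eq_single i
      (fun j _ hj => by rw [c.e_homV hj.symm, neg_add_cancel]) (by simp)
  rw [map_sum, ← Finset.sum_add_distrib, Finset.sum_congr rfl fun i _ => hterm i]
  exact c.eq_projV_add_sum a

theorem sub_projV_mem_range {a : V} (ha : (∑ i, d i) a = 0) :
    a - c.projV a ∈ LinearMap.range (∑ i, e i) :=
  ⟨∑ i, c.homV i a, by
    have h := c.eq_projV_add_total a
    simp only [ha, map_zero, Finset.sum_const_zero, add_zero] at h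
    exact (sub_eq_of_eq_add' h).symm⟩

theorem mem_range_iff {a : V} (ha : (∑ i, d i) a = 0) :
    a ∈ LinearMap.range (∑ i, e i) ↔ c.projV a = 0 := by
  refine ⟨?_, fun h => by simpa [h] using c.sub_projV_mem_range ha⟩
  rintro ⟨v, rfl⟩
  simp [c.projV_e]

end

section Fin

variable {k : ℕ} {d : Fin (k + 1) → V →ₗ[R] W} {e : Fin (k + 1) → W →ₗ[R] V}
  (c : JointContraction d e)

/-- The map induced by `projV` on the homology of the last pair. -/
def homologyProj : Homology (d (Fin.last k)) (e (Fin.last k)) →ₗ[R]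
    Homology (d (Fin.last k)) (e (Fin.last k)) :=
  homologyMap c.projV (fun a _ => c.d_projV _ a)
    (fun v => by rw [c.projV_e]; exact zero_mem _)

/-- The map induced by `homV i`, for `i` not the last index, on the homology of the last pair. -/
def homologyHom (i : Fin k) : Homology (d (Fin.last k)) (e (Fin.last k)) →ₗ[R]
    Homology (e (Fin.last k)) (d (Fin.last k)) :=
  homologyMap (c.homV i.castSucc)
    (fun a ha => by rw [c.e_homV i.castSucc_ne_last, ha, map_zero, neg_zero])
    (fun v => ⟨-c.homW i.castSucc v, by
      rw [map_neg, neg_eq_iff_eq_neg]; exact c.symm.e_homV i.castSucc_ne_last v⟩)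

variable
  {d' : Fin k → Homology (d (Fin.last k)) (e (Fin.last k)) →ₗ[R]
    Homology (e (Fin.last k)) (d (Fin.last k))}
  {e' : Fin k → Homology (e (Fin.last k)) (d (Fin.last k)) →ₗ[R]
    Homology (d (Fin.last k)) (e (Fin.last k))}

theorem induces_homologyProj : Induces c.projV c.homologyProj := induces_homologyMap _ _ _

theorem induces_homologyHom (i : Fin k) : Induces (c.homV i.castSucc) (c.homologyHom i) :=
  induces_homologyMap _ _ _

theorem homology_homotopy (hd : ∀ i, Induces (d i.castSucc) (d' i))
    (he : ∀ i, Induces (e i.castSucc) (e' i)) :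
    LinearMap.id = c.homologyProj +
      ∑ i, (e' i ∘ₗ c.homologyHom i + c.symm.homologyHom i ∘ₗ d' i) := by
  have hsum := Induces.sum (s := Finset.univ) fun i _ =>
    ((he i).comp (c.induces_homologyHom i)).add ((c.symm.induces_homologyHom i).comp (hd i))
  refine Induces.id.eq_of_sub_mem_range (c.induces_homologyProj.add hsum) fun a ha => ?_
  refine ⟨c.homV (Fin.last k) a, ?_⟩
  have h := c.eq_projV_add_sum a
  rw [Fin.sum_univ_castSucc, ha, map_zero, add_zero, ← add_assoc] at h
  rw [eq_sub_iff_add_eq']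
  simpa [symm] using h.symm

theorem homology_anticomm (hd : ∀ i, Induces (d i.castSucc) (d' i))
    (he : ∀ i, Induces (e i.castSucc) (e' i)) {i j : Fin k} (hij : i ≠ j) :
    e' j ∘ₗ c.homologyHom i + c.symm.homologyHom i ∘ₗ d' j = 0 := by
  refine Induces.eq (f := 0) ?_ Induces.zero
  rw [← c.anticommV i.castSucc j.castSucc (by simpa using hij)]
  exact ((he j).comp (c.induces_homologyHom i)).add ((c.symm.induces_homologyHom i).comp (hd j))

theorem homology_comp_proj (hd : ∀ i, Induces (d i.castSucc) (d' i)) (i : Fin k) :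
    d' i ∘ₗ c.homologyProj = 0 := by
  refine Induces.eq (f := 0) ?_ Induces.zero
  rw [← c.d_comp_projV i.castSucc]
  exact (hd i).comp c.induces_homologyProj

theorem homology_proj_comp (he : ∀ i, Induces (e i.castSucc) (e' i)) (i : Fin k) :
    c.homologyProj ∘ₗ e' i = 0 := by
  refine Induces.eq (f := 0) ?_ Induces.zero
  rw [← c.projV_comp_e i.castSucc]
  exact c.induces_homologyProj.comp (he i)

/-- The homotopies induced on the homology of the last pair, for operators `d'` and `e'` induced by
the remaining pairs. -/
def homology (hd : ∀ i, Induces (d i.castSucc) (d' i))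
    (he : ∀ i, Induces (e i.castSucc) (e' i)) : JointContraction d' e' where
  projV := c.homologyProj
  projW := c.symm.homologyProj
  homV := c.homologyHom
  homW := c.symm.homologyHom
  d_comp_projV := c.homology_comp_proj hd
  e_comp_projW := c.symm.homology_comp_proj he
  projW_comp_d := c.symm.homology_proj_comp hd
  projV_comp_e := c.homology_proj_comp he
  homotopyV := c.homology_homotopy hd he
  homotopyW := c.symm.homology_homotopy he hd
  anticommV _ _ := c.homology_anticomm hd he
  anticommW _ _ := c.symm.homology_anticomm he hd

end Fin

end JointContraction

end JointContraction

/-! ### Quotients of the common centralizer -/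

namespace LieSuperalgebra

variable (g : LieSuperalgebra.{u}) {x : g.odd}

theorem sq_rep_eq_zero {a : g.even} {v : g.odd} (ha : g.rep a x = 0) (hv : g.sq x v = 0) :
    g.sq x (g.rep a v) = 0 := by
  have h := g.lie_sq a x v
  rw [ha, hv, lie_zero, map_zero, LinearMap.zero_apply, zero_add] at h
  exact h.symm

theorem rep_sq_eq_zero {v w : g.odd} (hv : g.sq x v = 0) (hw : g.sq x w = 0) :
    g.rep (g.sq v w) x = 0 := by
  rw [g.jacobi', g.sq_comm w, hv, hw]
  simp only [map_zero, LinearMap.zero_apply, neg_zero, sub_zero]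

end LieSuperalgebra

namespace CartanPair

/-- A homomorphism of Lie superalgebras mapping the distinguished subspace `𝔥` into `𝔥'`. -/
structure Hom (g g' : CartanPair.{u}) where
  even : g.even →ₗ[ℂ] g'.even
  odd : g.odd →ₗ[ℂ] g'.odd
  map_lie : ∀ a b, even ⁅a, b⁆ = ⁅even a, even b⁆
  map_rep : ∀ a v, odd (g.rep a v) = g'.rep (even a) (odd v)
  map_sq : ∀ v w, even (g.sq v w) = g'.sq (odd v) (odd w)
  map_cartan : ∀ a ∈ g.cartan, even a ∈ g'.cartan

namespace Hom

variable {g g' g'' : CartanPair.{u}}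

/-- The composition of two homomorphisms. -/
def comp (q : Hom g' g'') (p : Hom g g') : Hom g g'' where
  even := q.even ∘ₗ p.even
  odd := q.odd ∘ₗ p.odd
  map_lie a b := (congrArg q.even (p.map_lie a b)).trans (q.map_lie _ _)
  map_rep a v := (congrArg q.odd (p.map_rep a v)).trans (q.map_rep _ _)
  map_sq v w := (congrArg q.even (p.map_sq v w)).trans (q.map_sq _ _)
  map_cartan a ha := q.map_cartan _ (p.map_cartan a ha)

/-- The map `𝔥 → 𝔥'` given by a homomorphism. -/
def cartanMap (p : Hom g g') : g.cartan →ₗ[ℂ] g'.cartan := p.even.restrict p.map_cartan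

/-- `p : 𝔤 → 𝔤'` is surjective, also as a map `𝔥 → 𝔥'`, with kernel `K ⊕ L`. -/
structure IsQuotientBy (p : Hom g g') (K : Submodule ℂ g.even) (L : Submodule ℂ g.odd) :
    Prop where
  even_surjective : Function.Surjective p.even
  odd_surjective : Function.Surjective p.odd
  cartanMap_surjective : Function.Surjective p.cartanMap
  ker_even : LinearMap.ker p.even = K
  ker_odd : LinearMap.ker p.odd = L

namespace IsQuotientBy

variable {p : Hom g g'} {q : Hom g g''} {K : Submodule ℂ g.even} {L : Submodule ℂ g.odd}

/-- The isomorphism `𝔤' ≃ 𝔤''` of the even parts of two quotients by the same kernel. -/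
def evenEquiv (hp : p.IsQuotientBy K L) (hq : q.IsQuotientBy K L) : g'.even ≃ₗ[ℂ] g''.even :=
  (p.even.quotKerEquivOfSurjective hp.even_surjective).symm ≪≫ₗ
    Submodule.quotEquivOfEq _ _ (hp.ker_even.trans hq.ker_even.symm) ≪≫ₗ
      q.even.quotKerEquivOfSurjective hq.even_surjective

/-- The isomorphism `𝔤' ≃ 𝔤''` of the odd parts of two quotients by the same kernel. -/
def oddEquiv (hp : p.IsQuotientBy K L) (hq : q.IsQuotientBy K L) : g'.odd ≃ₗ[ℂ] g''.odd :=
  (p.odd.quotKerEquivOfSurjective hp.odd_surjective).symm ≪≫ₗ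
    Submodule.quotEquivOfEq _ _ (hp.ker_odd.trans hq.ker_odd.symm) ≪≫ₗ
      q.odd.quotKerEquivOfSurjective hq.odd_surjective

theorem evenEquiv_apply (hp : p.IsQuotientBy K L) (hq : q.IsQuotientBy K L) (a : g.even) :
    hp.evenEquiv hq (p.even a) = q.even a := by
  have h : (p.even.quotKerEquivOfSurjective hp.even_surjective).symm (p.even a) =
      Submodule.Quotient.mk a := (LinearEquiv.symm_apply_eq _).2 rfl
  simp only [evenEquiv, LinearEquiv.trans_apply, h, Submodule.quotEquivOfEq_mk]
  rfl

theorem oddEquiv_apply (hp : p.IsQuotientBy K L) (hq : q.IsQuotientBy K L) (v : g.odd) :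
    hp.oddEquiv hq (p.odd v) = q.odd v := by
  have h : (p.odd.quotKerEquivOfSurjective hp.odd_surjective).symm (p.odd v) =
      Submodule.Quotient.mk v := (LinearEquiv.symm_apply_eq _).2 rfl
  simp only [oddEquiv, LinearEquiv.trans_apply, h, Submodule.quotEquivOfEq_mk]
  rfl

theorem range_cartanMap (hp : p.IsQuotientBy K L) : g.cartan.map p.even = g'.cartan := by
  refine le_antisymm (Submodule.map_le_iff_le_comap.2 p.map_cartan) fun z hz => ?_
  obtain ⟨a, ha⟩ := hp.cartanMap_surjective ⟨z, hz⟩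
  exact ⟨a, a.2, congrArg Subtype.val ha⟩

/-- Two quotients of `𝔤` by the same kernel are isomorphic. -/
def iso (hp : p.IsQuotientBy K L) (hq : q.IsQuotientBy K L) : Iso g' g'' where
  even := hp.evenEquiv hq
  odd := hp.oddEquiv hq
  map_lie a b := by
    obtain ⟨a, rfl⟩ := hp.even_surjective a
    obtain ⟨b, rfl⟩ := hp.even_surjective b
    rw [← p.map_lie]
    simp only [hp.evenEquiv_apply hq, q.map_lie]
  map_rep a v := by
    obtain ⟨a, rfl⟩ := hp.even_surjective a
    obtain ⟨v, rfl⟩ := hp.odd_surjective v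
    rw [← p.map_rep]
    simp only [hp.evenEquiv_apply hq, hp.oddEquiv_apply hq, q.map_rep]
  map_sq v w := by
    obtain ⟨v, rfl⟩ := hp.odd_surjective v
    obtain ⟨w, rfl⟩ := hp.odd_surjective w
    rw [← p.map_sq]
    simp only [hp.evenEquiv_apply hq, hp.oddEquiv_apply hq, q.map_sq]
  map_cartan := by
    have h : (hp.evenEquiv hq : g'.even →ₗ[ℂ] g''.even) ∘ₗ p.even = q.even :=
      LinearMap.ext (hp.evenEquiv_apply hq)
    rw [← hp.range_cartanMap, ← Submodule.map_comp, h, hq.range_cartanMap]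

theorem iso_cartanEquiv_symm_comp (hp : p.IsQuotientBy K L) (hq : q.IsQuotientBy K L) :
    ((hp.iso hq).cartanEquiv.symm : g''.cartan →ₗ[ℂ] g'.cartan) ∘ₗ q.cartanMap = p.cartanMap := by
  refine LinearMap.ext fun a => (LinearEquiv.symm_apply_eq _).2 (Subtype.ext ?_)
  exact (hp.evenEquiv_apply hq a).symm

end IsQuotientBy

end Hom

section CommonCentralizer

variable {ι : Type*} (g : CartanPair.{u}) (x : ι → g.odd)

/-- The even part of `⋂ᵢ 𝔤^{xᵢ}`. -/
def evenCommonCentralizer : LieSubalgebra ℂ g.even where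
  carrier := {a | ∀ i, g.rep a (x i) = 0}
  zero_mem' := by simp
  add_mem' ha hb i := by rw [map_add, LinearMap.add_apply, ha i, hb i, add_zero]
  smul_mem' r a ha i := by rw [map_smul, LinearMap.smul_apply, ha i, smul_zero]
  lie_mem' ha hb i := by rw [g.rep_lie, ha i, hb i, map_zero, map_zero, sub_zero]

/-- The odd part of `⋂ᵢ 𝔤^{xᵢ}`. -/
def oddCommonCentralizer : Submodule ℂ g.odd where
  carrier := {v | ∀ i, g.sq (x i) v = 0}
  zero_mem' := by simp
  add_mem' hv hw i := by rw [map_add, hv i, hw i, add_zero]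
  smul_mem' r v hv i := by rw [map_smul, hv i, smul_zero]

/-- The Lie superalgebra `⋂ᵢ 𝔤^{xᵢ}` with the subspace `𝔥 ∩ ⋂ᵢ 𝔤^{xᵢ}`. -/
def commonCentralizer : CartanPair.{u} where
  even := g.evenCommonCentralizer x
  odd := g.oddCommonCentralizer x
  rep := LinearMap.mk₂ ℂ (fun a v => ⟨g.rep a v, fun i => g.sq_rep_eq_zero (a.2 i) (v.2 i)⟩)
    (fun _ _ _ => Subtype.ext (g.rep.map_add₂ _ _ _))
    (fun _ _ _ => Subtype.ext (g.rep.map_smul₂ _ _ _))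
    (fun _ _ _ => Subtype.ext (map_add _ _ _)) (fun _ _ _ => Subtype.ext (map_smul _ _ _))
  sq := LinearMap.mk₂ ℂ (fun v w => ⟨g.sq v w, fun i => g.rep_sq_eq_zero (v.2 i) (w.2 i)⟩)
    (fun _ _ _ => Subtype.ext (g.sq.map_add₂ _ _ _))
    (fun _ _ _ => Subtype.ext (g.sq.map_smul₂ _ _ _))
    (fun _ _ _ => Subtype.ext (map_add _ _ _)) (fun _ _ _ => Subtype.ext (map_smul _ _ _))
  rep_lie a b v := Subtype.ext (g.rep_lie a b v)
  sq_comm v w := Subtype.ext (g.sq_comm v w)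
  lie_sq a v w := Subtype.ext (g.lie_sq a v w)
  jacobi u v w := Subtype.ext (g.jacobi u v w)
  cartan := g.cartan.submoduleOf (g.evenCommonCentralizer x).toSubmodule
  cartan_comm a ha b hb := Subtype.ext (g.cartan_comm a ha b hb)

/-- The inclusion `⋂ᵢ 𝔤^{xᵢ} → 𝔤`. -/
def commonCentralizerIncl : Hom (g.commonCentralizer x) g where
  even := (g.evenCommonCentralizer x).toSubmodule.subtype
  odd := (g.oddCommonCentralizer x).subtype
  map_lie _ _ := rfl
  map_rep _ _ := rfl
  map_sq _ _ := rfl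
  map_cartan _ ha := ha

end CommonCentralizer

section ClassMaps

variable {g : CartanPair.{u}} {k : ℕ}

/-- The class map `⋂ᵢ 𝔤^{xᵢ} → 𝔤_{x₁ + ⋯ + x_k}`. -/
def sumClass (x : Fin k → g.odd) (hx : ∀ i j, g.sq (x i) (x j) = 0) :
    Hom (g.commonCentralizer x) (g.ds (∑ i, x i) (sq_sum x hx)) where
  even := (g.evenBoundary (∑ i, x i)).toSubmodule.mkQ ∘ₗ
    Submodule.inclusion fun _ ha => rep_sum x ha
  odd := ((g.oddBoundary (∑ i, x i)).submoduleOf _).mkQ ∘ₗ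
    Submodule.inclusion fun _ hv => sq_sum_left x hv
  map_lie _ _ := rfl
  map_rep _ _ := rfl
  map_sq _ _ := rfl
  map_cartan a ha := ⟨⟨a.1, rep_sum x a.2⟩, ha, rfl⟩

/-- The class map from `⋂ᵢ 𝔤^{xᵢ}`, `i ≤ k + 1`, to the common centraliser of the classes of
`x₁, …, x_k` in `𝔤_{x_{k+1}}`. -/
def lastClass (x : Fin (k + 1) → g.odd) (hx : ∀ i j, g.sq (x i) (x j) = 0) :
    Hom (g.commonCentralizer x)
      ((g.ds (x (Fin.last k)) (hx _ _)).commonCentralizer (descend x hx)) where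
  even :=
    { toFun a := ⟨g.evenClass _ (hx _ _) a.1 (a.2 _), descend_rep x hx a.1 a.2⟩
      map_add' _ _ := rfl
      map_smul' _ _ := rfl }
  odd :=
    { toFun v := ⟨g.oddClass _ (hx _ _) v.1 (v.2 _), descend_sq_left x hx v.1 v.2⟩
      map_add' _ _ := rfl
      map_smul' _ _ := rfl }
  map_lie _ _ := rfl
  map_rep _ _ := rfl
  map_sq _ _ := rfl
  map_cartan a ha := ⟨⟨a.1, a.2 _⟩, ha, rfl⟩

/-- The class map from `⋂ᵢ 𝔤^{xᵢ}` to the iterated algebra. -/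
def iterClass : (k : ℕ) → (g : CartanPair.{u}) → (x : Fin k → g.odd) →
    (hx : ∀ i j, g.sq (x i) (x j) = 0) → Hom (g.commonCentralizer x) (iter k g x hx)
  | 0, g, x, _ => g.commonCentralizerIncl x
  | k + 1, _, x, hx => (iterClass k _ (descend x hx) (descend_sq x hx)).comp (lastClass x hx)

theorem iterClass_even : ∀ (k : ℕ) (g : CartanPair.{u}) (x : Fin k → g.odd)
    (hx : ∀ i j, g.sq (x i) (x j) = 0) (a : g.even) (ha : ∀ i, g.rep a (x i) = 0),
    (iterClass k g x hx).even ⟨a, ha⟩ = iterEven k g x hx a ha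
  | 0, _, _, _, _, _ => rfl
  | k + 1, _, x, hx, a, ha => iterClass_even k _ (descend x hx) (descend_sq x hx)
      _ (descend_rep x hx a ha)

theorem iterClass_odd : ∀ (k : ℕ) (g : CartanPair.{u}) (x : Fin k → g.odd)
    (hx : ∀ i j, g.sq (x i) (x j) = 0) (v : g.odd) (hv : ∀ i, g.sq (x i) v = 0),
    (iterClass k g x hx).odd ⟨v, hv⟩ = iterOdd k g x hx v hv
  | 0, _, _, _, _, _ => rfl
  | k + 1, _, x, hx, v, hv => iterClass_odd k _ (descend x hx) (descend_sq x hx)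
      _ (descend_sq_left x hx v hv)

end ClassMaps

/-- Simultaneous homotopies for the brackets `a ↦ [a, xᵢ]` on `𝔤₀` and `v ↦ [xᵢ, v]` on `𝔤₁`, whose
projection preserves `𝔥`. -/
structure Contraction (g : CartanPair.{u}) {k : ℕ} (x : Fin k → g.odd) extends
    JointContraction (fun i => g.rep.flip (x i)) (fun i => g.sq (x i)) where
  projV_cartan : ∀ a ∈ g.cartan, projV a ∈ g.cartan

namespace Contraction

variable {g : CartanPair.{u}} {k : ℕ}

/-- The homotopies induced on `𝔤_{x_{k+1}}`. -/
def descend {x : Fin (k + 1) → g.odd} (c : Contraction g x)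
    (hx : ∀ i j, g.sq (x i) (x j) = 0) :
    Contraction (g.ds (x (Fin.last k)) (hx _ _)) (CartanPair.descend x hx) where
  toJointContraction := c.homology (fun _ a => ⟨g.sq_rep_eq_zero a.2 (hx _ _), rfl⟩)
    (fun _ v => ⟨g.rep_sq_eq_zero (hx _ _) v.2, rfl⟩)
  projV_cartan := by
    rintro _ ⟨a, ha, rfl⟩
    exact ⟨⟨c.projV a, c.d_projV _ _⟩, c.projV_cartan a ha, rfl⟩

end Contraction

namespace Contraction

variable {g : CartanPair.{u}} {k : ℕ}

section

variable {x : Fin k → g.odd} (c : Contraction g x)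

/-- The kernel of the projection on the even part of `⋂ᵢ 𝔤^{xᵢ}`. -/
def evenKer : Submodule ℂ (g.commonCentralizer x).even :=
  LinearMap.ker (c.projV ∘ₗ (g.commonCentralizerIncl x).even)

/-- The kernel of the projection on the odd part of `⋂ᵢ 𝔤^{xᵢ}`. -/
def oddKer : Submodule ℂ (g.commonCentralizer x).odd :=
  LinearMap.ker (c.projW ∘ₗ (g.commonCentralizerIncl x).odd)

/-- The projection of an even element, as an element of `⋂ᵢ 𝔤^{xᵢ}`. -/
def evenProj (a : g.even) : (g.commonCentralizer x).even := ⟨c.projV a, fun i => c.d_projV i a⟩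

/-- The projection of an odd element, as an element of `⋂ᵢ 𝔤^{xᵢ}`. -/
def oddProj (v : g.odd) : (g.commonCentralizer x).odd := ⟨c.projW v, fun i => c.symm.d_projV i v⟩

theorem sumClass_evenProj (hx : ∀ i j, g.sq (x i) (x j) = 0) {a : g.even}
    (ha : g.rep a (∑ i, x i) = 0) :
    (sumClass x hx).even (c.evenProj a) = g.evenClass _ (sq_sum x hx) a ha := by
  refine Eq.symm ((Submodule.Quotient.eq (g.evenBoundary (∑ i, x i)).toSubmodule).2 ?_)
  change a - c.projV a ∈ LinearMap.range (g.sq (∑ i, x i))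
  rw [map_sum]
  exact c.sub_projV_mem_range (by rwa [← map_sum])

theorem sumClass_oddProj (hx : ∀ i j, g.sq (x i) (x j) = 0) {v : g.odd}
    (hv : g.sq (∑ i, x i) v = 0) :
    (sumClass x hx).odd (c.oddProj v) = g.oddClass _ (sq_sum x hx) v hv := by
  refine Eq.symm ((Submodule.Quotient.eq ((g.oddBoundary (∑ i, x i)).submoduleOf _)).2 ?_)
  change v - c.projW v ∈ LinearMap.range (g.rep.flip (∑ i, x i))
  rw [map_sum]
  exact c.symm.sub_projV_mem_range (by rwa [← map_sum])

theorem ker_sumClass_even (hx : ∀ i j, g.sq (x i) (x j) = 0) :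
    LinearMap.ker (sumClass x hx).even = c.evenKer := by
  ext a
  refine (Submodule.Quotient.mk_eq_zero (g.evenBoundary (∑ i, x i)).toSubmodule).trans ?_
  change a.1 ∈ LinearMap.range (g.sq (∑ i, x i)) ↔ c.projV a.1 = 0
  rw [map_sum]
  exact c.mem_range_iff (by rw [← map_sum]; exact rep_sum x a.2)

theorem ker_sumClass_odd (hx : ∀ i j, g.sq (x i) (x j) = 0) :
    LinearMap.ker (sumClass x hx).odd = c.oddKer := by
  ext v
  refine (Submodule.Quotient.mk_eq_zero ((g.oddBoundary (∑ i, x i)).submoduleOf _)).trans ?_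
  change v.1 ∈ LinearMap.range (g.rep.flip (∑ i, x i)) ↔ c.projW v.1 = 0
  rw [map_sum]
  exact c.symm.mem_range_iff (by rw [← map_sum]; exact sq_sum_left x v.2)

theorem sumClass_isQuotientBy (hx : ∀ i j, g.sq (x i) (x j) = 0) :
    (sumClass x hx).IsQuotientBy c.evenKer c.oddKer where
  even_surjective z := by
    induction z using Quotient.inductionOn' with | _ a
    exact ⟨c.evenProj a, c.sumClass_evenProj hx a.2⟩
  odd_surjective z := by
    induction z using Quotient.inductionOn' with | _ v
    exact ⟨c.oddProj v, c.sumClass_oddProj hx v.2⟩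
  cartanMap_surjective := by
    rintro ⟨_, a, ha, rfl⟩
    exact ⟨⟨c.evenProj a, c.projV_cartan a ha⟩, Subtype.ext (c.sumClass_evenProj hx a.2)⟩
  ker_even := c.ker_sumClass_even hx
  ker_odd := c.ker_sumClass_odd hx

theorem sub_evenProj_mem_evenKer (a : (g.commonCentralizer x).even) :
    a - c.evenProj a.1 ∈ c.evenKer := by
  change c.projV (a.1 - c.projV a.1) = 0
  rw [map_sub, c.projV_projV a.2, sub_self]

theorem sub_oddProj_mem_oddKer (v : (g.commonCentralizer x).odd) :
    v - c.oddProj v.1 ∈ c.oddKer := by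
  change c.projW (v.1 - c.projW v.1) = 0
  rw [map_sub, sub_eq_zero]
  exact (c.symm.projV_projV v.2).symm

variable {g' : CartanPair.{u}} {q : Hom (g.commonCentralizer x) g'}

theorem map_evenProj (hq : q.IsQuotientBy c.evenKer c.oddKer)
    (a : (g.commonCentralizer x).even) : q.even (c.evenProj a.1) = q.even a := by
  have h := c.sub_evenProj_mem_evenKer a
  rw [← hq.ker_even, LinearMap.mem_ker, map_sub] at h
  exact (sub_eq_zero.1 h).symm

theorem map_oddProj (hq : q.IsQuotientBy c.evenKer c.oddKer)
    (v : (g.commonCentralizer x).odd) : q.odd (c.oddProj v.1) = q.odd v := by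
  have h := c.sub_oddProj_mem_oddKer v
  rw [← hq.ker_odd, LinearMap.mem_ker, map_sub] at h
  exact (sub_eq_zero.1 h).symm

end

section

variable {x : Fin (k + 1) → g.odd} (c : Contraction g x)

theorem lastClass_even_mem_evenKer_iff (hx : ∀ i j, g.sq (x i) (x j) = 0)
    (a : (g.commonCentralizer x).even) :
    (lastClass x hx).even a ∈ (c.descend hx).evenKer ↔ a ∈ c.evenKer :=
  (Submodule.Quotient.mk_eq_zero (g.evenBoundary (x (Fin.last k))).toSubmodule).trans
    (c.projV_mem_range_iff a.2 (Fin.last k))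

theorem lastClass_odd_mem_oddKer_iff (hx : ∀ i j, g.sq (x i) (x j) = 0)
    (v : (g.commonCentralizer x).odd) :
    (lastClass x hx).odd v ∈ (c.descend hx).oddKer ↔ v ∈ c.oddKer :=
  (Submodule.Quotient.mk_eq_zero ((g.oddBoundary (x (Fin.last k))).submoduleOf _)).trans
    (c.symm.projV_mem_range_iff v.2 (Fin.last k))

/-- `lastClass x hx` itself need not be surjective, but its image contains the image of the
projection, which differs from the identity by elements of the kernel of `q`. -/
theorem isQuotientBy_comp_lastClass (hx : ∀ i j, g.sq (x i) (x j) = 0) {g' : CartanPair.{u}}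
    {q : Hom ((g.ds (x (Fin.last k)) (hx _ _)).commonCentralizer (CartanPair.descend x hx)) g'}
    (hq : q.IsQuotientBy (c.descend hx).evenKer (c.descend hx).oddKer) :
    (q.comp (lastClass x hx)).IsQuotientBy c.evenKer c.oddKer where
  even_surjective z := by
    obtain ⟨b, rfl⟩ := hq.even_surjective z
    rw [← (c.descend hx).map_evenProj hq b]
    obtain ⟨b, -⟩ := b
    induction b using Quotient.inductionOn' with | _ a
    exact ⟨c.evenProj a, rfl⟩
  odd_surjective z := by
    obtain ⟨w, rfl⟩ := hq.odd_surjective z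
    rw [← (c.descend hx).map_oddProj hq w]
    obtain ⟨w, -⟩ := w
    induction w using Quotient.inductionOn' with | _ v
    exact ⟨c.oddProj v, rfl⟩
  cartanMap_surjective z := by
    obtain ⟨⟨b, a, ha, hab⟩, rfl⟩ := hq.cartanMap_surjective z
    exact ⟨⟨c.evenProj a, c.projV_cartan a ha⟩, Subtype.ext <|
      (congrArg (fun z => q.even ((c.descend hx).evenProj z)) hab).trans
        ((c.descend hx).map_evenProj hq b)⟩
  ker_even := by
    ext a
    rw [← c.lastClass_even_mem_evenKer_iff hx, ← hq.ker_even]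
    rfl
  ker_odd := by
    ext v
    rw [← c.lastClass_odd_mem_oddKer_iff hx, ← hq.ker_odd]
    rfl

end

theorem evenKer_eq_bot {x : Fin 0 → g.odd} (c : Contraction g x) : c.evenKer = ⊥ := by
  refine (Submodule.eq_bot_iff _).2 fun a ha => Subtype.ext ?_
  have h := c.eq_projV_add_sum a.1
  rw [Fin.sum_univ_zero, add_zero] at h
  exact h.trans ha

theorem oddKer_eq_bot {x : Fin 0 → g.odd} (c : Contraction g x) : c.oddKer = ⊥ := by
  refine (Submodule.eq_bot_iff _).2 fun v hv => Subtype.ext ?_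
  have h := c.symm.eq_projV_add_sum v.1
  rw [Fin.sum_univ_zero, add_zero] at h
  exact h.trans hv

theorem iterClass_isQuotientBy : ∀ {k : ℕ} {g : CartanPair.{u}} {x : Fin k → g.odd}
    (c : Contraction g x) (hx : ∀ i j, g.sq (x i) (x j) = 0),
    (iterClass k g x hx).IsQuotientBy c.evenKer c.oddKer
  | 0, _, _, c, _ =>
    { even_surjective := fun z => ⟨⟨z, fun i => i.elim0⟩, rfl⟩
      odd_surjective := fun z => ⟨⟨z, fun i => i.elim0⟩, rfl⟩
      cartanMap_surjective := fun z => ⟨⟨⟨z.1, fun i => i.elim0⟩, z.2⟩, rfl⟩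
      ker_even := c.evenKer_eq_bot ▸ LinearMap.ker_eq_bot.2 Subtype.val_injective
      ker_odd := c.oddKer_eq_bot ▸ LinearMap.ker_eq_bot.2 Subtype.val_injective }
  | _ + 1, _, x, c, hx =>
    c.isQuotientBy_comp_lastClass hx (iterClass_isQuotientBy (c.descend hx) (descend_sq x hx))

/-- The isomorphism between `𝔤_{x₁ + ⋯ + x_k}` and the iterated algebra, as quotients of
`⋂ᵢ 𝔤^{xᵢ}`. -/
def iso {x : Fin k → g.odd} (c : Contraction g x) (hx : ∀ i j, g.sq (x i) (x j) = 0) :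
    (g.ds (∑ i, x i) (sq_sum x hx)).Iso (iter k g x hx) :=
  (c.sumClass_isQuotientBy hx).iso (c.iterClass_isQuotientBy hx)

variable {x : Fin k → g.odd} (c : Contraction g x) (hx : ∀ i j, g.sq (x i) (x j) = 0)

theorem iso_evenClass (a : g.even) (ha : ∀ i, g.rep a (x i) = 0) :
    (c.iso hx).even (g.evenClass _ (sq_sum x hx) a (rep_sum x ha)) = iterEven k g x hx a ha :=
  ((c.sumClass_isQuotientBy hx).evenEquiv_apply (c.iterClass_isQuotientBy hx) ⟨a, ha⟩).trans
    (iterClass_even k g x hx a ha)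

theorem iso_oddClass (v : g.odd) (hv : ∀ i, g.sq (x i) v = 0) :
    (c.iso hx).odd (g.oddClass _ (sq_sum x hx) v (sq_sum_left x hv)) = iterOdd k g x hx v hv :=
  ((c.sumClass_isQuotientBy hx).oddEquiv_apply (c.iterClass_isQuotientBy hx) ⟨v, hv⟩).trans
    (iterClass_odd k g x hx v hv)

end Contraction

section Supercharacters

theorem pullback_comp {t t' t'' : Type*} [AddCommGroup t] [Module ℂ t] [AddCommGroup t']
    [Module ℂ t'] [AddCommGroup t''] [Module ℂ t''] (π : t' →ₗ[ℂ] t) (ρ : t'' →ₗ[ℂ] t')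
    (f : AddMonoidAlgebra ℤ (Module.Dual ℂ t)) :
    pullback ρ (pullback π f) = pullback (π ∘ₗ ρ) f := by
  apply AddMonoidAlgebra.coeff_injective
  change Finsupp.mapDomain _ (Finsupp.mapDomain _ f.coeff) = Finsupp.mapDomain _ f.coeff
  rw [← Finsupp.mapDomain_comp]
  rfl

variable {g : CartanPair.{u}}

theorem pullback_toCartanDS_dsHom (x : g.odd) (hx : g.sq x x = 0) (f : J g) :
    pullback (toCartanDS x hx) (dsHom x hx f : AddMonoidAlgebra ℤ _) =
      pullback (toCartan x) (f : AddMonoidAlgebra ℤ _) := by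
  obtain ⟨m, rfl⟩ := (schHom g).rangeRestrict_surjective f
  have hds : dsHom x hx ((schHom g).rangeRestrict m) = dsFree x hx m :=
    AddMonoidHom.liftOfRightInverse_comp_apply (schHom g).rangeRestrict _
      (Function.rightInverse_surjInv (schHom g).rangeRestrict_surjective)
      ⟨dsFree x hx, ker_le x hx⟩ m
  rw [hds]
  exact (pullback_schHom x hx m).symm

theorem pullback_dsHom {L : Type*} [AddCommGroup L] [Module ℂ L] {x : g.odd} {hx : g.sq x x = 0}
    {φ : L →ₗ[ℂ] g.cartan} (hφ : ∀ l, g.rep (φ l) x = 0) {ψ : L →ₗ[ℂ] (g.ds x hx).cartan}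
    (hψ : ∀ l, (ψ l : (g.ds x hx).even) = g.evenClass x hx (φ l) (hφ l)) (f : J g) :
    pullback ψ (dsHom x hx f : AddMonoidAlgebra ℤ _) = pullback φ (f : AddMonoidAlgebra ℤ _) := by
  let χ : L →ₗ[ℂ] g.cartanCentralizer x :=
    LinearMap.codRestrict _ ((g.cartan.subtype ∘ₗ φ).codRestrict _ hφ) fun l => (φ l).2
  have hψχ : ψ = toCartanDS x hx ∘ₗ χ := LinearMap.ext fun l => Subtype.ext (hψ l)
  have hφχ : φ = toCartan x ∘ₗ χ := rfl
  rw [hψχ, ← pullback_comp, pullback_toCartanDS_dsHom, pullback_comp, ← hφχ]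

theorem pullback_sumClass_dsHom {k : ℕ} (x : Fin k → g.odd) (hx : ∀ i j, g.sq (x i) (x j) = 0)
    (f : J g) :
    pullback (sumClass x hx).cartanMap (dsHom (∑ i, x i) (sq_sum x hx) f : AddMonoidAlgebra ℤ _) =
      pullback (g.commonCentralizerIncl x).cartanMap (f : AddMonoidAlgebra ℤ _) :=
  pullback_dsHom (fun a => rep_sum x a.1.2) (fun _ => rfl) f

theorem pullback_iterClass_dsComp : ∀ (k : ℕ) (g : CartanPair.{u}) (x : Fin k → g.odd)
    (hx : ∀ i j, g.sq (x i) (x j) = 0) (f : J g),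
    pullback (iterClass k g x hx).cartanMap (dsComp k g x hx f : AddMonoidAlgebra ℤ _) =
      pullback (g.commonCentralizerIncl x).cartanMap (f : AddMonoidAlgebra ℤ _)
  | 0, _, _, _, _ => rfl
  | k + 1, g, x, hx, f => by
    have ih := pullback_iterClass_dsComp k _ (descend x hx) (descend_sq x hx)
      (dsHom (x (Fin.last k)) (hx _ _) f)
    refine (pullback_comp (iterClass k _ (descend x hx) (descend_sq x hx)).cartanMap
      (lastClass x hx).cartanMap _).symm.trans ?_
    refine (congrArg (pullback (lastClass x hx).cartanMap) ih).trans ?_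
    exact (pullback_comp _ _ _).trans (pullback_dsHom (fun a => a.1.2 _) (fun _ => rfl) f)

theorem Contraction.transport_iso_dsHom {k : ℕ} {x : Fin k → g.odd} (c : Contraction g x)
    (hx : ∀ i j, g.sq (x i) (x j) = 0) (f : J g) :
    (c.iso hx).transport (dsHom (∑ i, x i) (sq_sum x hx) f) =
      (dsComp k g x hx f : AddMonoidAlgebra ℤ (Module.Dual ℂ (iter k g x hx).cartan)) := by
  apply pullback_injective _ (c.iterClass_isQuotientBy hx).cartanMap_surjective
  rw [Iso.transport, pullback_comp, pullback_iterClass_dsComp, ← pullback_sumClass_dsHom x hx]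
  exact congrArg (fun π => pullback π (dsHom (∑ i, x i) (sq_sum x hx) f : AddMonoidAlgebra ℤ _))
    ((c.sumClass_isQuotientBy hx).iso_cartanEquiv_symm_comp (c.iterClass_isQuotientBy hx))

end Supercharacters

end CartanPair

/-! ### Lie algebras and linear algebra -/

section LieAlgebra

theorem eq_zero_of_hasEigenvalue_lie {K V : Type*} [Field K] [CharZero K] [AddCommGroup V]
    [Module K V] [FiniteDimensional K V] {A B : Module.End K V} (hA : Commute ⁅A, B⁆ A)
    (hB : Commute ⁅A, B⁆ B) {c : K} (hc : Module.End.HasEigenvalue ⁅A, B⁆ c) : c = 0 := by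
  let U := Module.End.eigenspace ⁅A, B⁆ c
  let A' : Module.End K U := A.restrict (Module.End.mapsTo_genEigenspace_of_comm hA c 1)
  let B' : Module.End K U := B.restrict (Module.End.mapsTo_genEigenspace_of_comm hB c 1)
  have hscalar : ⁅A', B'⁆ = c • 1 :=
    LinearMap.ext fun u => Subtype.ext (Module.End.mem_eigenspace_iff.1 u.2)
  have htrace := congrArg (LinearMap.trace K U) hscalar
  rw [LinearMap.trace_lie, map_smul, LinearMap.trace_one, smul_eq_mul] at htrace
  have : Nontrivial U := Submodule.nontrivial_iff_ne_bot.2 hc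
  exact (mul_eq_zero.1 htrace.symm).resolve_right
    (Nat.cast_ne_zero.2 (Module.finrank_pos (R := K) (M := U)).ne')

theorem eq_zero_of_lie_eq_smul {K L M : Type*} [Field K] [CharZero K] [LieRing L] [LieAlgebra K L]
    [AddCommGroup M] [Module K M] [LieRingModule L M] [LieModule K L M] [FiniteDimensional K M]
    {e f : L} (he : ⁅⁅e, f⁆, e⁆ = 0) (hf : ⁅⁅e, f⁆, f⁆ = 0) {c : K} {v : M}
    (hv : ⁅⁅e, f⁆, v⁆ = c • v) (hv0 : v ≠ 0) : c = 0 := by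
  let ρ (a : L) : Module.End K M := LieModule.toEnd K L M a
  have hρ (a b : L) : ⁅ρ a, ρ b⁆ = ρ ⁅a, b⁆ := LinearMap.ext fun w => (lie_lie a b w).symm
  refine eq_zero_of_hasEigenvalue_lie (A := ρ e) (B := ρ f) ?_ ?_
    (Module.End.hasEigenvalue_of_hasEigenvector (x := v)
      ⟨Module.End.mem_eigenspace_iff.2 (by rw [hρ]; exact hv), hv0⟩)
  · rw [commute_iff_lie_eq, hρ, hρ, he]
    exact map_zero _
  · rw [commute_iff_lie_eq, hρ, hρ, hf]
    exact map_zero _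

/-- The centre has an ideal complement, which contains all brackets. -/
theorem lie_eq_zero_of_mem_center {R L : Type*} [CommRing R] [LieRing L] [LieAlgebra R L]
    [ComplementedLattice (LieIdeal R L)] {e f : L} (h : ⁅e, f⁆ ∈ LieAlgebra.center R L) :
    ⁅e, f⁆ = 0 := by
  obtain ⟨K, hK⟩ := exists_isCompl (LieAlgebra.center R L)
  have hsplit (b : L) : ∃ z ∈ LieAlgebra.center R L, ∃ y ∈ K, z + y = b :=
    (LieSubmodule.mem_sup _ _ _).1 (hK.sup_eq_top ▸ LieSubmodule.mem_top b)
  obtain ⟨z, hz, y, hy, rfl⟩ := hsplit e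
  obtain ⟨z', hz', y', hy', rfl⟩ := hsplit f
  rw [LieModule.mem_maxTrivSubmodule] at hz hz'
  have hlie : ⁅z + y, z' + y'⁆ = ⁅y, y'⁆ := by
    rw [lie_add, hz', zero_add, add_lie, ← lie_skew, hz, neg_zero, zero_add]
  rw [hlie] at h ⊢
  have hmem : ⁅y, y'⁆ ∈ LieAlgebra.center R L ⊓ K := ⟨h, lie_mem_right R L K y y' hy'⟩
  rwa [hK.inf_eq_bot, LieSubmodule.mem_bot] at hmem

section IsSl2Triple

variable {R L M : Type*} [CommRing R] [CharZero R] [IsDomain R] [LieRing L] [LieAlgebra R L]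
  [AddCommGroup M] [Module R M] [LieRingModule L M] [LieModule R L M] [IsNoetherian R M]
  [Module.IsTorsionFree R M] {h e f : L}

theorem eq_zero_of_lie_f_eq_zero (t : IsSl2Triple h e f) {w : M} {m : ℕ} (hm : 0 < m)
    (hw : ⁅h, w⁆ = (m : R) • w) (hfw : ⁅f, w⁆ = 0) : w = 0 := by
  by_contra hw0
  have hprim : t.symm.HasPrimitiveVectorWith w (-m : R) :=
    ⟨hw0, by rw [neg_lie, hw, neg_smul], hfw⟩
  obtain ⟨n, hn⟩ := hprim.exists_nat
  have hnm : ((n + m : ℕ) : R) = 0 := by rw [Nat.cast_add, ← hn, neg_add_cancel]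
  have := Nat.cast_eq_zero.1 hnm
  lia

theorem eq_zero_of_lie_f_lie_f_eq_zero (t : IsSl2Triple h e f) {w : M}
    (hw : ⁅h, w⁆ = (4 : R) • w) (hfw : ⁅f, ⁅f, w⁆⁆ = 0) : w = 0 := by
  have hweight : ⁅h, ⁅f, w⁆⁆ = ((2 : ℕ) : R) • ⁅f, w⁆ := by
    rw [leibniz_lie, t.lie_h_f_nsmul, hw, lie_smul, neg_lie, nsmul_lie]
    module
  exact eq_zero_of_lie_f_eq_zero (R := R) t (m := 4) (by norm_num) (by exact_mod_cast hw)
    (eq_zero_of_lie_f_eq_zero (R := R) t two_pos hweight hfw)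

end IsSl2Triple

end LieAlgebra

section LinearAlgebra

theorem exists_dual_family {K V ι : Type*} [Field K] [AddCommGroup V] [Module K V]
    [FiniteDimensional K V] [DecidableEq ι] {β : ι → Module.Dual K V}
    (hβ : LinearIndependent K β) : ∃ h : ι → V, ∀ i j, β j (h i) = if i = j then 1 else 0 := by
  obtain ⟨p, hp⟩ := (Finsupp.linearCombination K β).exists_leftInverse_of_injective
    (LinearMap.ker_eq_bot.2 hβ)
  refine ⟨fun i => (Module.evalEquiv K V).symm (Finsupp.lapply i ∘ₗ p), fun i j => ?_⟩
  have hpβ : p (β j) = Finsupp.single j 1 := by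
    simpa using LinearMap.congr_fun hp (Finsupp.single j 1)
  rw [Module.apply_evalEquiv_symm_apply, LinearMap.comp_apply, hpβ, Finsupp.lapply_apply,
    Finsupp.single_apply]
  exact if_congr eq_comm rfl rfl

variable {R V V' ι : Type*} [CommRing R] [AddCommGroup V] [Module R V] [AddCommGroup V']
  [Module R V']

theorem linearMap_eq_of_iSup_eq_top {U : ι → Submodule R V} (htop : ⨆ i, U i = ⊤)
    {p q : V →ₗ[R] V'} (h : ∀ i, ∀ v ∈ U i, p v = q v) : p = q :=
  LinearMap.eqLocus_eq_top.1 (top_le_iff.1 (htop ▸ iSup_le h))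

theorem exists_mem_apply_eq_one {K V : Type*} [Field K] [AddCommGroup V] [Module K V]
    {U : ι → Submodule K V} (htop : ⨆ i, U i = ⊤) {f : Module.Dual K V} (hf : f ≠ 0) {i : ι}
    (hfU : ∀ j ≠ i, ∀ v ∈ U j, f v = 0) : ∃ v ∈ U i, f v = 1 := by
  have hfi : ∃ v ∈ U i, f v ≠ 0 := by
    by_contra! h
    refine hf (linearMap_eq_of_iSup_eq_top htop fun j v hv => ?_)
    rcases eq_or_ne j i with rfl | hj
    exacts [h v hv, hfU j hj v hv]
  obtain ⟨v, hv, hfv⟩ := hfi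
  exact ⟨(f v)⁻¹ • v, Submodule.smul_mem _ _ hv, by
    rw [map_smul, smul_eq_mul, inv_mul_cancel₀ hfv]⟩

/-- The endomorphism that acts on the summand `U i` of an internal direct sum as the scalar
`φ i`. -/
def scale {U : ι → Submodule R V} (hU : iSupIndep U) (htop : ⨆ i, U i = ⊤) (φ : ι → R) :
    V →ₗ[R] V := by
  classical
  exact DirectSum.toModule R ι V (fun i => φ i • (U i).subtype) ∘ₗ
    (LinearEquiv.ofBijective (DirectSum.coeLinearMap U)
      (DirectSum.isInternal_submodule_of_iSupIndep_of_iSup_eq_top hU htop)).symm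

variable {U : ι → Submodule R V} (hU : iSupIndep U) (htop : ⨆ i, U i = ⊤)

theorem scale_apply (φ : ι → R) {i : ι} {v : V} (hv : v ∈ U i) :
    scale hU htop φ v = φ i • v := by
  classical
  have hdecomp : (LinearEquiv.ofBijective (DirectSum.coeLinearMap U)
      (DirectSum.isInternal_submodule_of_iSupIndep_of_iSup_eq_top hU htop)).symm v =
      DirectSum.lof R ι (fun i => U i) i ⟨v, hv⟩ :=
    (LinearEquiv.symm_apply_eq _).2 (DirectSum.coeLinearMap_lof U i ⟨v, hv⟩).symm
  simp only [scale, LinearMap.comp_apply, LinearEquiv.coe_coe, hdecomp, DirectSum.toModule_lof]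
  rfl

theorem scale_comm {ι' : Type*} {U' : ι' → Submodule R V'} (hU' : iSupIndep U')
    (htop' : ⨆ i, U' i = ⊤) {φ : ι → R} {φ' : ι' → R} {σ : ι → ι'} (hφ : ∀ i, φ' (σ i) = φ i)
    {p : V →ₗ[R] V'} (hp : ∀ i, ∀ v ∈ U i, p v ∈ U' (σ i)) (v : V) :
    scale hU' htop' φ' (p v) = p (scale hU htop φ v) := by
  refine LinearMap.congr_fun (f := scale hU' htop' φ' ∘ₗ p) (g := p ∘ₗ scale hU htop φ)
    (linearMap_eq_of_iSup_eq_top htop fun i v hv => ?_) v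
  simp only [LinearMap.comp_apply, scale_apply hU' htop' φ' (hp i v hv), hφ,
    scale_apply hU htop φ hv, map_smul]

/-- The normalised conjugate `τ̄ / |τ|²` of a vector, and `0` for `τ = 0`. -/
def conjInv {k : ℕ} (τ : Fin k → ℂ) : Fin k → ℂ := (star τ ⬝ᵥ τ)⁻¹ • star τ

open scoped ComplexOrder in
theorem sum_conjInv_mul {k : ℕ} (τ : Fin k → ℂ) :
    ∑ i, conjInv τ i * τ i = if τ = 0 then 0 else 1 := by
  have h : ∑ i, conjInv τ i * τ i = (star τ ⬝ᵥ τ)⁻¹ * (star τ ⬝ᵥ τ) := smul_dotProduct _ _ _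
  split_ifs with hτ
  · rw [h, hτ, dotProduct_zero, mul_zero]
  · rw [h, inv_mul_cancel₀ (dotProduct_star_self_eq_zero.not.2 hτ)]

theorem iSupIndep_of_forall_eq_smul {t V : Type*} [AddCommGroup t] [Module ℂ t] [AddCommGroup V]
    [Module ℂ V] {T : t →ₗ[ℂ] Module.End ℂ V} (hT : ∀ a b, Commute (T a) (T b))
    {U : Module.Dual ℂ t → Submodule ℂ V} (hU : ∀ μ, ∀ v ∈ U μ, ∀ a, T a v = μ a • v) :
    iSupIndep U := by
  refine (weightSpace_indep T hT).mono fun μ v hv => (mem_weightSpace T μ v).2 fun a => ⟨1, ?_⟩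
  rw [pow_one, LinearMap.sub_apply]
  exact sub_eq_zero.2 (hU μ v hv a)

end LinearAlgebra

/-! ### Roots and the invariant form -/

namespace CartanPair

variable {g : CartanPair.{u}}

theorem lie_mem_evenRootSpace {α β : Module.Dual ℂ g.cartan} {a b : g.even}
    (ha : a ∈ g.evenRootSpace α) (hb : b ∈ g.evenRootSpace β) :
    ⁅a, b⁆ ∈ g.evenRootSpace (α + β) := fun h => by
  rw [leibniz_lie, ha h, hb h, smul_lie, lie_smul, ← add_smul, LinearMap.add_apply]

theorem rep_mem_oddRootSpace {α β : Module.Dual ℂ g.cartan} {a : g.even} {v : g.odd}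
    (ha : a ∈ g.evenRootSpace α) (hv : v ∈ g.oddRootSpace β) :
    g.rep a v ∈ g.oddRootSpace (α + β) := fun h => by
  have hrep := g.rep_lie h a v
  rw [ha h, hv h, map_smul, map_smul, LinearMap.smul_apply] at hrep
  rw [LinearMap.add_apply, add_smul, hrep, sub_add_cancel]

theorem sq_mem_evenRootSpace {α β : Module.Dual ℂ g.cartan} {v w : g.odd}
    (hv : v ∈ g.oddRootSpace α) (hw : w ∈ g.oddRootSpace β) :
    g.sq v w ∈ g.evenRootSpace (α + β) := fun h => by
  rw [g.lie_sq, hv h, hw h, map_smul, map_smul, LinearMap.smul_apply, LinearMap.add_apply,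
    add_smul]

theorem iSupIndep_evenRootSpace : iSupIndep g.evenRootSpace := by
  let T : g.cartan →ₗ[ℂ] Module.End ℂ g.even :=
    (LieAlgebra.ad ℂ g.even : g.even →ₗ[ℂ] Module.End ℂ g.even) ∘ₗ g.cartan.subtype
  refine iSupIndep_of_forall_eq_smul (T := T) (fun a b => LinearMap.ext fun c => ?_)
    fun α a ha h => ha h
  change ⁅(a : g.even), ⁅(b : g.even), c⁆⁆ = ⁅(b : g.even), ⁅(a : g.even), c⁆⁆
  rw [leibniz_lie, g.cartan_comm a a.2 b b.2, zero_lie, zero_add]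

theorem iSupIndep_oddRootSpace : iSupIndep g.oddRootSpace := by
  refine iSupIndep_of_forall_eq_smul (T := g.rep ∘ₗ g.cartan.subtype)
    (fun a b => LinearMap.ext fun v => ?_) fun α v hv h => hv h
  have hrep := g.rep_lie a b v
  rw [g.cartan_comm a a.2 b b.2, map_zero, LinearMap.zero_apply] at hrep
  exact sub_eq_zero.1 hrep.symm

theorem IsReductivePair.mem_cartan (hg : g.IsReductivePair) {a : g.even}
    {α : Module.Dual ℂ g.cartan} (ha : a ∈ g.evenRootSpace α) (hα : α = 0) : a ∈ g.cartan := by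
  rwa [hα, hg.even_zero] at ha

namespace InvariantForm

section Pairing

variable (F : g.InvariantForm) {α β : Module.Dual ℂ g.cartan}

theorem even_eq_zero {a b : g.even} (ha : a ∈ g.evenRootSpace α) (hb : b ∈ g.evenRootSpace β)
    (hαβ : α + β ≠ 0) : F.even a b = 0 := by
  by_contra h0
  refine hαβ (LinearMap.ext fun h => ?_)
  have hinv := F.even_invariant a h b
  rw [← lie_skew, ha h, hb h, map_neg, map_smul, map_smul, LinearMap.neg_apply,
    LinearMap.smul_apply, smul_eq_mul, smul_eq_mul] at hinv
  have hmul : (α h + β h) * F.even a b = 0 := by linear_combination -hinv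
  exact (mul_eq_zero.1 hmul).resolve_right h0

theorem odd_eq_zero {v w : g.odd} (hv : v ∈ g.oddRootSpace α) (hw : w ∈ g.oddRootSpace β)
    (hαβ : α + β ≠ 0) : F.odd v w = 0 := by
  by_contra h0
  refine hαβ (LinearMap.ext fun h => ?_)
  have hinv : F.odd (g.rep h v) w = -F.odd v (g.rep h w) := by
    rw [F.odd_invariant, g.sq_comm, ← F.odd_invariant, F.odd_skew]
  rw [hv h, hw h, map_smul, map_smul, LinearMap.smul_apply, smul_eq_mul, smul_eq_mul] at hinv
  have hmul : (α h + β h) * F.odd v w = 0 := by linear_combination hinv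
  exact (mul_eq_zero.1 hmul).resolve_right h0

theorem exists_even_eq_one (hg : g.IsReductivePair) {a : g.even} (ha : a ∈ g.evenRootSpace α)
    (ha0 : a ≠ 0) : ∃ b ∈ g.evenRootSpace (-α), F.even a b = 1 :=
  exists_mem_apply_eq_one hg.iSup_even
    (fun h => ha0 (F.even_nondegenerate a (LinearMap.congr_fun h)))
    fun _ hγ _ hb => F.even_eq_zero ha hb fun h => hγ (eq_neg_of_add_eq_zero_right h)

theorem exists_odd_eq_one (hg : g.IsReductivePair) {v : g.odd} (hv : v ∈ g.oddRootSpace α)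
    (hv0 : v ≠ 0) : ∃ w ∈ g.oddRootSpace (-α), F.odd v w = 1 :=
  exists_mem_apply_eq_one hg.iSup_odd
    (fun h => hv0 (F.odd_nondegenerate v (LinearMap.congr_fun h)))
    fun _ hγ _ hw => F.odd_eq_zero hv hw fun h => hγ (eq_neg_of_add_eq_zero_right h)

end Pairing

variable (F : g.InvariantForm) (hg : g.IsReductivePair)

section CartanDual

include hg in
theorem eq_zero_of_mem_cartan {t : g.even} (ht : t ∈ g.cartan)
    (h : ∀ s : g.cartan, F.even t s = 0) : t = 0 := by
  by_contra h0
  obtain ⟨f, hf, hone⟩ := F.exists_even_eq_one hg (hg.even_zero.ge ht) h0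
  rw [h ⟨f, hg.mem_cartan hf neg_zero⟩] at hone
  exact zero_ne_one hone

/-- The isomorphism `𝔥 ≃ 𝔥^*`, `t ↦ (t, ·)`. -/
def cartanEquivDual : g.cartan ≃ₗ[ℂ] Module.Dual ℂ g.cartan :=
  haveI := hg.finite_even
  LinearMap.linearEquivOfInjective (F.even.domRestrict₁₂ g.cartan g.cartan)
    ((injective_iff_map_eq_zero _).2 fun t ht => Subtype.ext <|
      F.eq_zero_of_mem_cartan hg t.2 fun s => LinearMap.congr_fun ht s)
    Subspace.dual_finrank_eq.symm

/-- The element `t_α ∈ 𝔥` that represents `α ∈ 𝔥^*`, so that `(α, β) = β(t_α)`. -/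
def vec : Module.Dual ℂ g.cartan →ₗ[ℂ] g.cartan :=
  (F.cartanEquivDual hg).symm

theorem even_vec (α : Module.Dual ℂ g.cartan) (h : g.cartan) : F.even (F.vec hg α) h = α h :=
  LinearMap.congr_fun ((F.cartanEquivDual hg).apply_symm_apply α) h

theorem vec_ne_zero {α : Module.Dual ℂ g.cartan} (hα : α ≠ 0) : (F.vec hg α : g.even) ≠ 0 :=
  fun h => hα ((map_eq_zero_iff _ (F.cartanEquivDual hg).symm.injective).1 (Subtype.ext h))

theorem eq_smul_vec {t : g.even} (ht : t ∈ g.cartan) {α : Module.Dual ℂ g.cartan} {c : ℂ}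
    (h : ∀ s : g.cartan, F.even t s = c * α s) : t = c • (F.vec hg α : g.even) := by
  rw [← sub_eq_zero]
  refine F.eq_zero_of_mem_cartan hg
    (sub_mem ht (Submodule.smul_mem _ _ (F.vec hg α).2)) fun s => ?_
  rw [map_sub, LinearMap.sub_apply, map_smul, LinearMap.smul_apply, F.even_vec, h, smul_eq_mul,
    sub_self]

theorem apply_vec_comm (α β : Module.Dual ℂ g.cartan) :
    α (F.vec hg β) = β (F.vec hg α) := by
  rw [← F.even_vec hg α, F.even_symm, F.even_vec]

theorem orthogonal_iff {α β : Module.Dual ℂ g.cartan} :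
    F.Orthogonal α β ↔ β (F.vec hg α) = 0 := by
  refine ⟨fun ⟨t, ht, hβt⟩ => ?_, fun h => ⟨F.vec hg α, F.even_vec hg α, h⟩⟩
  have htα : F.cartanEquivDual hg t = α := LinearMap.ext ht
  rwa [vec, ← htα, LinearEquiv.coe_coe, LinearEquiv.symm_apply_apply]

theorem lie_eq_smul_vec {γ : Module.Dual ℂ g.cartan} {e f : g.even}
    (he : e ∈ g.evenRootSpace γ) (hf : f ∈ g.evenRootSpace (-γ)) :
    ⁅e, f⁆ = F.even e f • (F.vec hg γ : g.even) := by
  refine F.eq_smul_vec hg (hg.mem_cartan (lie_mem_evenRootSpace he hf) (add_neg_cancel γ))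
    fun s => ?_
  rw [F.even_invariant, ← lie_skew, hf s, map_neg, map_smul, LinearMap.neg_apply, smul_eq_mul]
  ring

theorem sq_eq_smul_vec {γ : Module.Dual ℂ g.cartan} {v w : g.odd}
    (hv : v ∈ g.oddRootSpace γ) (hw : w ∈ g.oddRootSpace (-γ)) :
    g.sq v w = F.odd v w • (F.vec hg γ : g.even) := by
  refine F.eq_smul_vec hg (hg.mem_cartan (sq_mem_evenRootSpace hv hw) (add_neg_cancel γ))
    fun s => ?_
  rw [F.even_symm, ← F.odd_invariant, hv s, map_smul, LinearMap.smul_apply, smul_eq_mul, mul_comm]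

end CartanDual

section EvenRoots

include F hg

theorem lie_eq_zero_of_isotropic {γ : Module.Dual ℂ g.cartan} (hγ : γ (F.vec hg γ) = 0)
    {e f : g.even} (he : e ∈ g.evenRootSpace γ) (hf : f ∈ g.evenRootSpace (-γ)) :
    ⁅e, f⁆ = 0 := by
  have := hg.finite_even
  have := hg.reductive
  have hlie {α : Module.Dual ℂ g.cartan} {a : g.even} (ha : a ∈ g.evenRootSpace α) :
      ⁅⁅e, f⁆, a⁆ = (F.even e f * α (F.vec hg γ)) • a := by
    rw [F.lie_eq_smul_vec hg he hf, smul_lie, ha, smul_smul]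
  have hlie_e : ⁅⁅e, f⁆, e⁆ = 0 := by rw [hlie he, hγ, mul_zero, zero_smul]
  have hlie_f : ⁅⁅e, f⁆, f⁆ = 0 := by
    rw [hlie hf, LinearMap.neg_apply, hγ, neg_zero, mul_zero, zero_smul]
  have hcentral : (LieAlgebra.ad ℂ g.even ⁅e, f⁆ : Module.End ℂ g.even) = 0 :=
    linearMap_eq_of_iSup_eq_top hg.iSup_even fun α a ha => by
      rw [LieAlgebra.ad_apply, LinearMap.zero_apply]
      by_contra ha0
      have hc := eq_zero_of_lie_eq_smul hlie_e hlie_f (hlie ha) fun h => ha0 (by rw [h, lie_zero])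
      exact ha0 (by rw [hlie ha, hc, zero_smul])
  refine lie_eq_zero_of_mem_center (R := ℂ) ((LieModule.mem_maxTrivSubmodule _ _ _ _).2 fun b => ?_)
  rw [← lie_skew, ← LieAlgebra.ad_apply (R := ℂ), hcentral, LinearMap.zero_apply, neg_zero]

theorem even_eq_zero_of_isotropic {γ : Module.Dual ℂ g.cartan} (hγ : γ ≠ 0)
    (hγγ : γ (F.vec hg γ) = 0) {e : g.even} (he : e ∈ g.evenRootSpace γ) : e = 0 := by
  by_contra he0
  obtain ⟨f, hf, hone⟩ := F.exists_even_eq_one hg he he0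
  have hlie := F.lie_eq_smul_vec hg he hf
  rw [F.lie_eq_zero_of_isotropic hg hγγ he hf, hone, one_smul] at hlie
  exact F.vec_ne_zero hg hγ hlie.symm

theorem exists_isSl2Triple {γ : Module.Dual ℂ g.cartan} (hγ : γ ≠ 0) {e : g.even}
    (he : e ∈ g.evenRootSpace γ) (he0 : e ≠ 0) : ∃ f ∈ g.evenRootSpace (-γ),
      IsSl2Triple ((2 / γ (F.vec hg γ)) • (F.vec hg γ : g.even)) e f := by
  have hγγ : γ (F.vec hg γ) ≠ 0 := fun h => he0 (F.even_eq_zero_of_isotropic hg hγ h he)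
  obtain ⟨f, hf, hone⟩ := F.exists_even_eq_one hg he he0
  refine ⟨(2 / γ (F.vec hg γ)) • f, Submodule.smul_mem _ _ hf,
    smul_ne_zero (div_ne_zero two_ne_zero hγγ) (F.vec_ne_zero hg hγ), ?_, ?_, ?_⟩
  · rw [lie_smul, F.lie_eq_smul_vec hg he hf, hone, one_smul]
  · rw [smul_lie, he, smul_smul, div_mul_cancel₀ _ hγγ, ofNat_smul_eq_nsmul]
  · rw [smul_lie, lie_smul, hf, LinearMap.neg_apply, neg_smul, smul_neg, smul_neg, neg_inj,
      smul_comm, smul_smul _ (γ _), div_mul_cancel₀ _ hγγ, ofNat_smul_eq_nsmul, smul_comm]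

theorem eq_zero_of_mem_evenRootSpace_add_two_nsmul {γ δ : Module.Dual ℂ g.cartan} {e u : g.even}
    (hγ : γ ≠ 0) (he : e ∈ g.evenRootSpace γ) (he0 : e ≠ 0)
    (hu : u ∈ g.evenRootSpace (δ + 2 • γ)) (hδ : δ (F.vec hg γ) = 0)
    (hbot : g.evenRootSpace δ = ⊥) : u = 0 := by
  have := hg.finite_even
  have hγγ : γ (F.vec hg γ) ≠ 0 := fun h => he0 (F.even_eq_zero_of_isotropic hg hγ h he)
  obtain ⟨f, hf, hsl2⟩ := F.exists_isSl2Triple hg hγ he he0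
  refine eq_zero_of_lie_f_lie_f_eq_zero (R := ℂ) hsl2 ?_ ((Submodule.mem_bot ℂ).1 (hbot ▸ ?_))
  · rw [smul_lie, hu, smul_smul, LinearMap.add_apply, hδ, LinearMap.smul_apply]
    congr 1
    simp only [nsmul_eq_mul, Nat.cast_ofNat, zero_add]
    field_simp
    norm_num
  · convert lie_mem_evenRootSpace hf (lie_mem_evenRootSpace hf hu) using 2
    abel

end EvenRoots

section OrthogonalRoots

variable {α β : Module.Dual ℂ g.cartan} {x : g.odd}

include F hg

theorem sq_self_ne_zero (hα : α (F.vec hg α) ≠ 0) {v : g.odd} (hv : v ∈ g.oddRootSpace α)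
    (hv0 : v ≠ 0) : g.sq v v ≠ 0 := fun hvv => by
  obtain ⟨w, hw, hone⟩ := F.exists_odd_eq_one hg hv hv0
  have hjac := g.jacobi v v w
  rw [g.sq_comm w v, hvv, map_zero, LinearMap.zero_apply, zero_add, F.sq_eq_smul_vec hg hv hw,
    hone, one_smul, hv, ← two_smul ℂ, smul_smul, smul_eq_zero] at hjac
  exact hjac.elim (mul_ne_zero two_ne_zero hα) hv0

variable (hβ : β ≠ 0) (hββ : β (F.vec hg β) = 0)
include hβ hββ

theorem evenRootSpace_smul_eq_bot {c : ℂ} (hc : c ≠ 0) : g.evenRootSpace (c • β) = ⊥ :=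
  (Submodule.eq_bot_iff _).2 fun _ he =>
    F.even_eq_zero_of_isotropic hg (smul_ne_zero hc hβ) (by simp [hββ]) he

/-- If `v = [a, x] ≠ 0`, then `[v, v] ≠ 0` has weight `2α + 2β`, against
`eq_zero_of_mem_evenRootSpace_add_two_nsmul`. -/
theorem rep_eq_zero_of_orthogonal (hx : x ∈ g.oddRootSpace β) (hα : α ≠ 0)
    (hαβ : α (F.vec hg β) = 0) {a : g.even} (ha : a ∈ g.evenRootSpace α) : g.rep a x = 0 := by
  by_contra hax
  have ha0 : a ≠ 0 := fun h => hax (by rw [h, map_zero, LinearMap.zero_apply])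
  have hβα : β (F.vec hg α) = 0 := by rw [F.apply_vec_comm, hαβ]
  have hαα : α (F.vec hg α) ≠ 0 := fun h => ha0 (F.even_eq_zero_of_isotropic hg hα h ha)
  have hv := rep_mem_oddRootSpace ha hx
  refine F.sq_self_ne_zero hg (by simpa [hαβ, hβα, hββ] using hαα) hv hax ?_
  have hvv : g.sq (g.rep a x) (g.rep a x) ∈ g.evenRootSpace ((2 : ℂ) • β + 2 • α) := by
    convert sq_mem_evenRootSpace hv hv using 2
    module
  exact F.eq_zero_of_mem_evenRootSpace_add_two_nsmul hg hα ha ha0 hvv (by simp [hβα])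
    (F.evenRootSpace_smul_eq_bot hg hβ hββ two_ne_zero)

theorem sq_eq_zero_of_orthogonal (hx : x ∈ g.oddRootSpace β) (hα : β + α ≠ 0)
    (hαβ : α (F.vec hg β) = 0) {v : g.odd} (hv : v ∈ g.oddRootSpace α) : g.sq x v = 0 := by
  by_contra hxv
  have hv0 : v ≠ 0 := fun h => hxv (by rw [h, map_zero])
  have hβα : β (F.vec hg α) = 0 := by rw [F.apply_vec_comm, hαβ]
  have hw := sq_mem_evenRootSpace hx hv
  have hαα : α (F.vec hg α) ≠ 0 := fun h =>
    hxv (F.even_eq_zero_of_isotropic hg hα (by simp [hαβ, hβα, hββ, h]) hw)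
  refine F.sq_self_ne_zero hg hαα hv hv0 ?_
  have hvv : g.sq v v ∈ g.evenRootSpace ((-2 : ℂ) • β + 2 • (β + α)) := by
    convert sq_mem_evenRootSpace hv hv using 2
    module
  exact F.eq_zero_of_mem_evenRootSpace_add_two_nsmul hg hα hw hxv hvv (by simp [hβα, hββ])
    (F.evenRootSpace_smul_eq_bot hg hβ hββ (neg_ne_zero.2 two_ne_zero))

end OrthogonalRoots

namespace IsIsotropicSystem

variable {F : g.InvariantForm} (hg : g.IsReductivePair) {k : ℕ}
  {β : Fin k → Module.Dual ℂ g.cartan} (hβ : F.IsIsotropicSystem β)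
include hβ

theorem apply_vec (i j : Fin k) : β i (F.vec hg (β j)) = 0 := by
  rw [← F.orthogonal_iff]
  rcases eq_or_ne j i with rfl | h
  exacts [(hβ.root j).isotropic, hβ.orthogonal j i h]

theorem add_ne_zero (i j : Fin k) : β i + β j ≠ 0 := by
  rcases eq_or_ne i j with rfl | hij
  · rw [← two_smul ℂ]
    exact smul_ne_zero two_ne_zero (hβ.root i).ne_zero
  · intro hsum
    have hpair := (LinearIndepOn.pair_iff β hij).1 (hβ.independent.linearIndepOn _) (1 : ℂ) 1
    rw [one_smul, one_smul] at hpair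
    exact one_ne_zero (hpair hsum).1

include hg

theorem sq_eq_zero {x : Fin k → g.odd} (hx : ∀ i, x i ∈ g.oddRootSpace (β i)) (i j : Fin k) :
    g.sq (x i) (x j) = 0 :=
  F.even_eq_zero_of_isotropic hg (hβ.add_ne_zero i j) (by simp [hβ.apply_vec hg])
    (sq_mem_evenRootSpace (hx i) (hx j))

theorem sq_eq_zero_of_ne {x y : Fin k → g.odd} (hx : ∀ i, x i ∈ g.oddRootSpace (β i))
    (hy : ∀ i, y i ∈ g.oddRootSpace (-β i)) {i j : Fin k} (hij : i ≠ j) :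
    g.sq (x i) (y j) = 0 := by
  refine F.even_eq_zero_of_isotropic hg (γ := β i + -β j) ?_ (by simp [hβ.apply_vec hg])
    (sq_mem_evenRootSpace (hx i) (hy j))
  rw [← sub_eq_add_neg, sub_ne_zero]
  exact hβ.independent.injective.ne hij

end IsIsotropicSystem

end InvariantForm

end CartanPair

/-! ### Opposite root vectors and their homotopies -/

namespace CartanPair.InvariantForm

variable {g : CartanPair.{u}}

/-- Root vectors `y i` opposite to the odd root vectors `x i`, normalised by `(x i, y i) = 1`
unless `x i = 0`, together with elements `h i` of the Cartan subalgebra dual to the roots `β i`.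
With `[x i, y i]` they generate a copy of `𝔤𝔩(1|1)` for each `i`. -/
structure OppositeFrame (F : g.InvariantForm) {k : ℕ} (β : Fin k → Module.Dual ℂ g.cartan)
    (x : Fin k → g.odd) where
  y : Fin k → g.odd
  h : Fin k → g.cartan
  y_mem (i) : y i ∈ g.oddRootSpace (-β i)
  odd_smul (i) : F.odd (x i) (y i) • x i = x i
  apply_h (i j) : β j (h i) = if i = j then 1 else 0

variable {F : g.InvariantForm} (hg : g.IsReductivePair) {k : ℕ}
  {β : Fin k → Module.Dual ℂ g.cartan} {x : Fin k → g.odd}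
  (hx : ∀ i, x i ∈ g.oddRootSpace (β i))

include hg hx in
theorem nonempty_oppositeFrame (hβ : LinearIndependent ℂ β) : Nonempty (F.OppositeFrame β x) := by
  have := hg.finite_even
  have hopp (i : Fin k) : ∃ y ∈ g.oddRootSpace (-β i), F.odd (x i) y • x i = x i := by
    by_cases hxi : x i = 0
    · exact ⟨0, zero_mem _, by rw [hxi, smul_zero]⟩
    · obtain ⟨y, hy, hone⟩ := F.exists_odd_eq_one hg (hx i) hxi
      exact ⟨y, hy, by rw [hone, one_smul]⟩
  choose y y_mem odd_smul using hopp
  obtain ⟨h, apply_h⟩ := exists_dual_family hβ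
  exact ⟨⟨y, h, y_mem, odd_smul, apply_h⟩⟩

namespace OppositeFrame

variable (D : F.OppositeFrame β x)

section Coroot

/-- The even element `[x i, y i]`, a multiple of the element of `𝔥` that represents `β i`. -/
def coroot (i : Fin k) : g.even := g.sq (x i) (D.y i)

/-- The scalars by which the elements `[x i, y i]` act on the root spaces of `α`. -/
def height (α : Module.Dual ℂ g.cartan) (i : Fin k) : ℂ :=
  F.odd (x i) (D.y i) * α (F.vec hg (β i))

include hx

theorem coroot_eq_smul_vec (i : Fin k) :
    D.coroot i = F.odd (x i) (D.y i) • (F.vec hg (β i) : g.even) :=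
  F.sq_eq_smul_vec hg (hx i) (D.y_mem i)

include hg in
theorem coroot_mem_cartan (i : Fin k) : D.coroot i ∈ g.cartan :=
  hg.mem_cartan (sq_mem_evenRootSpace (hx i) (D.y_mem i)) (add_neg_cancel _)

theorem lie_coroot {α : Module.Dual ℂ g.cartan} {a : g.even} (ha : a ∈ g.evenRootSpace α)
    (i : Fin k) : ⁅D.coroot i, a⁆ = D.height hg α i • a := by
  rw [D.coroot_eq_smul_vec hg hx, smul_lie, ha, smul_smul, height]

theorem rep_coroot {α : Module.Dual ℂ g.cartan} {v : g.odd} (hv : v ∈ g.oddRootSpace α)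
    (i : Fin k) : g.rep (D.coroot i) v = D.height hg α i • v := by
  rw [D.coroot_eq_smul_vec hg hx, map_smul, LinearMap.smul_apply, hv, smul_smul, height]

theorem rep_h (i j : Fin k) : g.rep (D.h i) (x j) = if i = j then x j else 0 := by
  rw [hx j, D.apply_h, ite_smul, one_smul, zero_smul]

end Coroot

theorem height_zero : D.height hg 0 = 0 := funext fun _ => mul_zero _

theorem apply_vec_eq_zero {α : Module.Dual ℂ g.cartan} (hα : D.height hg α = 0) {j : Fin k}
    (hxj : x j ≠ 0) : α (F.vec hg (β j)) = 0 :=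
  (mul_eq_zero.1 (congrFun hα j)).resolve_left fun h => hxj (by
    rw [← D.odd_smul j, h, zero_smul])

section HeightScale

/-- The endomorphism of the even part that acts on a root space as the scalar determined by `ψ`
and the height of the root. -/
def evenScale (ψ : (Fin k → ℂ) → ℂ) : g.even →ₗ[ℂ] g.even :=
  scale iSupIndep_evenRootSpace hg.iSup_even fun α => ψ (D.height hg α)

/-- The odd counterpart of `evenScale`. -/
def oddScale (ψ : (Fin k → ℂ) → ℂ) : g.odd →ₗ[ℂ] g.odd :=
  scale iSupIndep_oddRootSpace hg.iSup_odd fun α => ψ (D.height hg α)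

variable {α : Module.Dual ℂ g.cartan} (ψ : (Fin k → ℂ) → ℂ)

theorem evenScale_apply {a : g.even} (ha : a ∈ g.evenRootSpace α) :
    D.evenScale hg ψ a = ψ (D.height hg α) • a :=
  scale_apply _ _ _ ha

theorem oddScale_apply {v : g.odd} (hv : v ∈ g.oddRootSpace α) :
    D.oddScale hg ψ v = ψ (D.height hg α) • v :=
  scale_apply _ _ _ hv

theorem evenScale_mem_cartan {a : g.even} (ha : a ∈ g.cartan) :
    D.evenScale hg ψ a ∈ g.cartan := by
  rw [D.evenScale_apply hg ψ (hg.even_zero.ge ha)]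
  exact Submodule.smul_mem _ _ ha

/-- The projection of the even part onto the root spaces of height zero. -/
def evenCore : g.even →ₗ[ℂ] g.even := D.evenScale hg fun τ => if τ = 0 then 1 else 0

/-- The projection of the odd part onto the root spaces of height zero. -/
def oddCore : g.odd →ₗ[ℂ] g.odd := D.oddScale hg fun τ => if τ = 0 then 1 else 0

/-- Endomorphisms of the even part such that `∑ i, ad [x i, y i] ∘ evenInv i` is the projection
onto the root spaces of nonzero height. -/
def evenInv (i : Fin k) : g.even →ₗ[ℂ] g.even := D.evenScale hg fun τ => conjInv τ i

/-- The odd counterpart of `evenInv`. -/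
def oddInv (i : Fin k) : g.odd →ₗ[ℂ] g.odd := D.oddScale hg fun τ => conjInv τ i

include hx

theorem evenCore_add_sum (a : g.even) :
    D.evenCore hg a + ∑ i, ⁅D.coroot i, D.evenInv hg i a⁆ = a := by
  suffices D.evenCore hg + ∑ i, (LieAlgebra.ad ℂ g.even (D.coroot i) : Module.End ℂ g.even) ∘ₗ
      D.evenInv hg i = LinearMap.id by
    simpa using LinearMap.congr_fun this a
  refine linearMap_eq_of_iSup_eq_top hg.iSup_even fun α a ha => ?_
  simp only [LinearMap.add_apply, LinearMap.sum_apply, LinearMap.comp_apply, LieAlgebra.ad_apply,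
    evenCore, evenInv, D.evenScale_apply hg _ ha, lie_smul, D.lie_coroot hg hx ha, smul_smul,
    ← Finset.sum_smul, sum_conjInv_mul, ← add_smul, LinearMap.id_apply]
  split_ifs <;> simp

theorem oddCore_add_sum (v : g.odd) :
    D.oddCore hg v + ∑ i, g.rep (D.coroot i) (D.oddInv hg i v) = v := by
  suffices D.oddCore hg + ∑ i, g.rep (D.coroot i) ∘ₗ D.oddInv hg i = LinearMap.id by
    simpa using LinearMap.congr_fun this v
  refine linearMap_eq_of_iSup_eq_top hg.iSup_odd fun α v hv => ?_
  simp only [LinearMap.add_apply, LinearMap.sum_apply, LinearMap.comp_apply, oddCore, oddInv,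
    D.oddScale_apply hg _ hv, map_smul, D.rep_coroot hg hx hv, smul_smul, ← Finset.sum_smul,
    sum_conjInv_mul, ← add_smul, LinearMap.id_apply]
  split_ifs <;> simp

end HeightScale

variable (hβ : F.IsIsotropicSystem β)
include hβ

section IsotropicHeight

theorem height_root (i : Fin k) : D.height hg (β i) = 0 :=
  funext fun j => by simp [height, hβ.apply_vec hg]

theorem height_neg_root (i : Fin k) : D.height hg (-β i) = 0 :=
  funext fun j => by simp [height, hβ.apply_vec hg]

theorem height_add_root (α : Module.Dual ℂ g.cartan) (i : Fin k) :
    D.height hg (α + β i) = D.height hg α :=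
  funext fun j => by simp [height, hβ.apply_vec hg]

include hx

include hg in
theorem rep_coroot_root (i j : Fin k) : g.rep (D.coroot i) (x j) = 0 := by
  rw [D.rep_coroot hg hx (hx j), D.height_root hg hβ, Pi.zero_apply, zero_smul]

include hg in
theorem sq_y (i j : Fin k) : g.sq (x j) (D.y i) = if i = j then D.coroot j else 0 := by
  split_ifs with hij
  · rw [hij, coroot]
  · exact hβ.sq_eq_zero_of_ne hg hx D.y_mem (Ne.symm hij)

theorem oddScale_rep (ψ : (Fin k → ℂ) → ℂ) (j : Fin k) (a : g.even) :
    D.oddScale hg ψ (g.rep a (x j)) = g.rep (D.evenScale hg ψ a) (x j) :=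
  scale_comm (p := g.rep.flip (x j)) (σ := (· + β j)) iSupIndep_evenRootSpace hg.iSup_even
    iSupIndep_oddRootSpace hg.iSup_odd
    (fun α => congrArg ψ (D.height_add_root hg hβ α j))
    (fun _ _ ha => rep_mem_oddRootSpace ha (hx j)) a

theorem evenScale_sq (ψ : (Fin k → ℂ) → ℂ) (j : Fin k) (v : g.odd) :
    D.evenScale hg ψ (g.sq (x j) v) = g.sq (x j) (D.oddScale hg ψ v) :=
  scale_comm (p := g.sq (x j)) (σ := (β j + ·)) iSupIndep_oddRootSpace hg.iSup_odd
    iSupIndep_evenRootSpace hg.iSup_even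
    (fun α => congrArg ψ (add_comm (β j) α ▸ D.height_add_root hg hβ α j))
    (fun _ _ hv => sq_mem_evenRootSpace (hx j) hv) v

theorem rep_eq_smul_of_height_eq_zero {α : Module.Dual ℂ g.cartan} (hα : D.height hg α = 0)
    {a : g.even} (ha : a ∈ g.evenRootSpace α) (j : Fin k) :
    g.rep a (x j) = F.even a (D.coroot j) • x j := by
  by_cases hα0 : α = 0
  · have hrep := hx j ⟨a, hg.mem_cartan ha hα0⟩
    rw [← F.even_vec hg, F.even_symm] at hrep
    rw [D.coroot_eq_smul_vec hg hx, map_smul, smul_eq_mul, mul_comm, mul_smul, D.odd_smul]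
    exact hrep
  · rw [F.even_eq_zero ha (hg.even_zero.ge (D.coroot_mem_cartan hg hx j)) (by rwa [add_zero]),
      zero_smul]
    by_cases hxj : x j = 0
    · rw [hxj, map_zero]
    · exact F.rep_eq_zero_of_orthogonal hg (hβ.root j).ne_zero (hβ.apply_vec hg j j) (hx j) hα0
        (D.apply_vec_eq_zero hg hα hxj) ha

theorem sq_eq_smul_of_height_eq_zero {α : Module.Dual ℂ g.cartan} (hα : D.height hg α = 0)
    {v : g.odd} (hv : v ∈ g.oddRootSpace α) (j : Fin k) :
    g.sq (x j) v = F.odd (x j) v • D.coroot j := by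
  by_cases hjα : β j + α = 0
  · rw [← neg_eq_of_add_eq_zero_right hjα] at hv
    rw [F.sq_eq_smul_vec hg (hx j) hv, D.coroot_eq_smul_vec hg hx, smul_smul, mul_comm,
      ← smul_eq_mul, ← LinearMap.smul_apply, ← map_smul, D.odd_smul]
  · rw [F.odd_eq_zero (hx j) hv hjα, zero_smul]
    by_cases hxj : x j = 0
    · rw [hxj, map_zero, LinearMap.zero_apply]
    · exact F.sq_eq_zero_of_orthogonal hg (hβ.root j).ne_zero (hβ.apply_vec hg j j) (hx j) hjα
        (D.apply_vec_eq_zero hg hα hxj) hv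

theorem rep_evenCore (j : Fin k) (a : g.even) :
    g.rep (D.evenCore hg a) (x j) = F.even a (D.coroot j) • x j := by
  refine LinearMap.congr_fun (f := g.rep.flip (x j) ∘ₗ D.evenCore hg)
    (g := (LinearMap.flip F.even (D.coroot j)).smulRight (x j))
    (linearMap_eq_of_iSup_eq_top hg.iSup_even fun α a ha => ?_) a
  simp only [LinearMap.comp_apply, LinearMap.flip_apply, LinearMap.smulRight_apply, evenCore,
    D.evenScale_apply hg _ ha, map_smul]
  split_ifs with hα
  · rw [one_smul, D.rep_eq_smul_of_height_eq_zero hg hx hβ hα ha]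
  · have hα0 : α ≠ 0 := fun h => hα (h ▸ D.height_zero hg)
    rw [F.even_eq_zero ha (hg.even_zero.ge (D.coroot_mem_cartan hg hx j)) (by rwa [add_zero]),
      zero_smul, zero_smul]

theorem sq_oddCore (j : Fin k) (v : g.odd) :
    g.sq (x j) (D.oddCore hg v) = F.odd (x j) v • D.coroot j := by
  refine LinearMap.congr_fun (f := g.sq (x j) ∘ₗ D.oddCore hg)
    (g := (F.odd (x j)).smulRight (D.coroot j))
    (linearMap_eq_of_iSup_eq_top hg.iSup_odd fun α v hv => ?_) v
  simp only [LinearMap.comp_apply, LinearMap.smulRight_apply, oddCore,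
    D.oddScale_apply hg _ hv, map_smul]
  split_ifs with hα
  · rw [one_smul, D.sq_eq_smul_of_height_eq_zero hg hx hβ hα hv]
  · have hjα : β j + α ≠ 0 := fun h => hα (by
      rw [← neg_eq_of_add_eq_zero_right h, D.height_neg_root hg hβ])
    rw [F.odd_eq_zero (hx j) hv hjα, zero_smul, zero_smul]

end IsotropicHeight

end OppositeFrame

end CartanPair.InvariantForm

namespace CartanPair.InvariantForm.OppositeFrame

variable {g : CartanPair.{u}} {F : g.InvariantForm} (hg : g.IsReductivePair) {k : ℕ}
  {β : Fin k → Module.Dual ℂ g.cartan} {x : Fin k → g.odd} (D : F.OppositeFrame β x)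

/-- The even component of the projection attached to an opposite frame. -/
def evenProj : g.even →ₗ[ℂ] g.even :=
  D.evenCore hg - ∑ i, ((LinearMap.flip F.even (D.h i)).smulRight (D.coroot i) +
    (LinearMap.flip F.even (D.coroot i)).smulRight (D.h i : g.even))

/-- The odd component of the projection attached to an opposite frame. -/
def oddProj : g.odd →ₗ[ℂ] g.odd :=
  D.oddCore hg - ∑ i, ((LinearMap.flip F.odd (D.y i)).smulRight (x i) +
    (F.odd (x i)).smulRight (D.y i))

/-- The even component of the `i`-th homotopy attached to an opposite frame. -/
def evenHom (i : Fin k) : g.even →ₗ[ℂ] g.odd :=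
  (LinearMap.flip F.even (D.h i)).smulRight (D.y i) - g.rep.flip (D.y i) ∘ₗ D.evenInv hg i

/-- The odd component of the `i`-th homotopy attached to an opposite frame. -/
def oddHom (i : Fin k) : g.odd →ₗ[ℂ] g.even :=
  (LinearMap.flip F.odd (D.y i)).smulRight (D.h i : g.even) - g.sq (D.y i) ∘ₗ D.oddInv hg i

theorem evenProj_apply (a : g.even) : D.evenProj hg a = D.evenCore hg a -
    ∑ i, (F.even a (D.h i) • D.coroot i + F.even a (D.coroot i) • (D.h i : g.even)) := by
  rw [evenProj, LinearMap.sub_apply, LinearMap.sum_apply]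
  rfl

theorem oddProj_apply (v : g.odd) : D.oddProj hg v = D.oddCore hg v -
    ∑ i, (F.odd v (D.y i) • x i + F.odd (x i) v • D.y i) := by
  rw [oddProj, LinearMap.sub_apply, LinearMap.sum_apply]
  rfl

theorem evenHom_apply (i : Fin k) (a : g.even) :
    D.evenHom hg i a = F.even a (D.h i) • D.y i - g.rep (D.evenInv hg i a) (D.y i) := rfl

theorem oddHom_apply (i : Fin k) (v : g.odd) :
    D.oddHom hg i v = F.odd v (D.y i) • (D.h i : g.even) - g.sq (D.y i) (D.oddInv hg i v) := rfl

variable (hx : ∀ i, x i ∈ g.oddRootSpace (β i)) (hβ : F.IsIsotropicSystem β)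
include hx

section Form

theorem even_sq_h (i j : Fin k) (v : g.odd) :
    F.even (g.sq (x j) v) (D.h i) = if i = j then F.odd (x j) v else 0 := by
  rw [F.even_symm, ← F.odd_invariant, D.rep_h hx]
  split_ifs <;> simp

theorem evenProj_mem_cartan {a : g.even} (ha : a ∈ g.cartan) : D.evenProj hg a ∈ g.cartan := by
  rw [D.evenProj_apply]
  exact sub_mem (D.evenScale_mem_cartan hg _ ha) (sum_mem fun i _ =>
    add_mem (Submodule.smul_mem _ _ (D.coroot_mem_cartan hg hx i))
      (Submodule.smul_mem _ _ (D.h i).2))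

include hg hβ

theorem even_sq_coroot (i j : Fin k) (v : g.odd) : F.even (g.sq (x j) v) (D.coroot i) = 0 := by
  rw [F.even_symm, ← F.odd_invariant, D.rep_coroot_root hg hx hβ, map_zero, LinearMap.zero_apply]

theorem odd_rep_y (i j : Fin k) (a : g.even) :
    F.odd (g.rep a (x j)) (D.y i) = if i = j then F.even a (D.coroot j) else 0 := by
  rw [F.odd_invariant, D.sq_y hg hx hβ]
  split_ifs <;> simp

theorem odd_rep_root (i j : Fin k) (a : g.even) : F.odd (x i) (g.rep a (x j)) = 0 := by
  rw [F.odd_skew, F.odd_invariant, hβ.sq_eq_zero hg hx, map_zero, neg_zero]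

end Form

include hβ

section Projection

theorem rep_evenProj (j : Fin k) (a : g.even) : g.rep (D.evenProj hg a) (x j) = 0 := by
  simp [D.evenProj_apply, D.rep_evenCore hg hx hβ, D.rep_coroot_root hg hx hβ, D.rep_h hx]

theorem sq_oddProj (j : Fin k) (v : g.odd) : g.sq (x j) (D.oddProj hg v) = 0 := by
  simp [D.oddProj_apply, D.sq_oddCore hg hx hβ, hβ.sq_eq_zero hg hx, D.sq_y hg hx hβ]

theorem oddProj_rep (j : Fin k) (a : g.even) : D.oddProj hg (g.rep a (x j)) = 0 := by
  have hcore : D.oddCore hg (g.rep a (x j)) = F.even a (D.coroot j) • x j :=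
    (D.oddScale_rep hg hx hβ _ j a).trans (D.rep_evenCore hg hx hβ j a)
  simp [D.oddProj_apply, hcore, D.odd_rep_y hg hx hβ, odd_rep_root hg hx hβ]

theorem evenProj_sq (j : Fin k) (v : g.odd) : D.evenProj hg (g.sq (x j) v) = 0 := by
  have hcore : D.evenCore hg (g.sq (x j) v) = F.odd (x j) v • D.coroot j :=
    (D.evenScale_sq hg hx hβ _ j v).trans (D.sq_oddCore hg hx hβ j v)
  simp [D.evenProj_apply, hcore, D.even_sq_h hx, D.even_sq_coroot hg hx hβ]

end Projection

section Homotopy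

theorem sq_evenHom_add_oddHom_rep (i j : Fin k) (a : g.even) :
    g.sq (x j) (D.evenHom hg i a) + D.oddHom hg i (g.rep a (x j)) =
      if i = j then ⁅D.coroot i, D.evenInv hg i a⁆ +
        (F.even a (D.h i) • D.coroot i + F.even a (D.coroot i) • (D.h i : g.even)) else 0 := by
  have hinv : D.oddInv hg i (g.rep a (x j)) = g.rep (D.evenInv hg i a) (x j) :=
    D.oddScale_rep hg hx hβ _ j a
  have hlie := g.lie_sq (D.evenInv hg i a) (x j) (D.y i)
  rw [g.sq_comm (g.rep _ (x j)), ← lie_skew, D.sq_y hg hx hβ] at hlie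
  rw [evenHom_apply, oddHom_apply, hinv, D.odd_rep_y hg hx hβ, map_sub, map_smul,
    D.sq_y hg hx hβ, sub_add_sub_comm, add_comm (g.sq (x j) _), ← hlie, sub_neg_eq_add, add_comm]
  split_ifs with hij
  · rw [hij]
  · simp

theorem rep_oddHom_add_evenHom_sq (i j : Fin k) (v : g.odd) :
    g.rep (D.oddHom hg i v) (x j) + D.evenHom hg i (g.sq (x j) v) =
      if i = j then g.rep (D.coroot i) (D.oddInv hg i v) +
        (F.odd v (D.y i) • x i + F.odd (x i) v • D.y i) else 0 := by
  have hinv : D.evenInv hg i (g.sq (x j) v) = g.sq (x j) (D.oddInv hg i v) :=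
    D.evenScale_sq hg hx hβ _ j v
  have hjac := g.jacobi (x j) (D.y i) (D.oddInv hg i v)
  rw [g.sq_comm (D.oddInv hg i v), D.sq_y hg hx hβ] at hjac
  have hrep : g.rep (g.sq (D.y i) (D.oddInv hg i v)) (x j) +
      g.rep (g.sq (x j) (D.oddInv hg i v)) (D.y i) =
      -g.rep (if i = j then D.coroot j else 0) (D.oddInv hg i v) := by
    rw [eq_neg_iff_add_eq_zero, ← hjac]
    abel
  rw [evenHom_apply, oddHom_apply, hinv, D.even_sq_h hx, map_sub, LinearMap.sub_apply, map_smul,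
    LinearMap.smul_apply, D.rep_h hx, sub_add_sub_comm, hrep, sub_neg_eq_add, add_comm]
  split_ifs with hij
  · rw [hij]
  · simp

theorem evenProj_add_sum (a : g.even) : a = D.evenProj hg a +
    ∑ i, (g.sq (x i) (D.evenHom hg i a) + D.oddHom hg i (g.rep a (x i))) := by
  simp only [D.sq_evenHom_add_oddHom_rep hg hx hβ, if_true, Finset.sum_add_distrib,
    D.evenProj_apply]
  nth_rewrite 1 [← D.evenCore_add_sum hg hx a]
  abel

theorem oddProj_add_sum (v : g.odd) : v = D.oddProj hg v +
    ∑ i, (g.rep (D.oddHom hg i v) (x i) + D.evenHom hg i (g.sq (x i) v)) := by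
  simp only [D.rep_oddHom_add_evenHom_sq hg hx hβ, if_true, Finset.sum_add_distrib,
    D.oddProj_apply]
  nth_rewrite 1 [← D.oddCore_add_sum hg hx v]
  abel

end Homotopy

/-- The contraction attached to an opposite frame of an isotropic system. -/
def contraction : Contraction g x where
  projV := D.evenProj hg
  projW := D.oddProj hg
  homV := D.evenHom hg
  homW := D.oddHom hg
  d_comp_projV j := LinearMap.ext (D.rep_evenProj hg hx hβ j)
  e_comp_projW j := LinearMap.ext (D.sq_oddProj hg hx hβ j)
  projW_comp_d j := LinearMap.ext (D.oddProj_rep hg hx hβ j)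
  projV_comp_e j := LinearMap.ext (D.evenProj_sq hg hx hβ j)
  homotopyV := LinearMap.ext fun a => by
    simpa using D.evenProj_add_sum hg hx hβ a
  homotopyW := LinearMap.ext fun v => by
    simpa using D.oddProj_add_sum hg hx hβ v
  anticommV i j hij := LinearMap.ext fun a =>
    (D.sq_evenHom_add_oddHom_rep hg hx hβ i j a).trans (if_neg hij)
  anticommW i j hij := LinearMap.ext fun v =>
    (D.rep_oddHom_add_evenHom_sq hg hx hβ i j v).trans (if_neg hij)
  projV_cartan _ := D.evenProj_mem_cartan hg hx

end CartanPair.InvariantForm.OppositeFrame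

end DufloSerganova

end

theorem mainTheorem3 (g : DufloSerganova.CartanPair.{u}) (hg : g.IsReductivePair)
    (F : g.InvariantForm) (k : ℕ) (β : Fin k → Module.Dual ℂ g.cartan)
    (hβ : F.IsIsotropicSystem β) (x : Fin k → g.odd) (hx : ∀ i, x i ∈ g.oddRootSpace (β i)) :
    ∃ (hc : ∀ i j, g.sq (x i) (x j) = 0)
      (Φ : (g.ds (∑ i, x i) (DufloSerganova.CartanPair.sq_sum x hc)).Iso
        (DufloSerganova.CartanPair.iter k g x hc)),
      (∀ (a : g.even) (ha : ∀ i, g.rep a (x i) = 0),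
        Φ.even (g.evenClass _ (DufloSerganova.CartanPair.sq_sum x hc) a
          (DufloSerganova.CartanPair.rep_sum x ha)) =
          DufloSerganova.CartanPair.iterEven k g x hc a ha) ∧
      (∀ (v : g.odd) (hv : ∀ i, g.sq (x i) v = 0),
        Φ.odd (g.oddClass _ (DufloSerganova.CartanPair.sq_sum x hc) v
          (DufloSerganova.CartanPair.sq_sum_left x hv)) =
          DufloSerganova.CartanPair.iterOdd k g x hc v hv) ∧
      ∀ f : DufloSerganova.CartanPair.J g,
        Φ.transport (DufloSerganova.CartanPair.dsHom (∑ i, x i)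
          (DufloSerganova.CartanPair.sq_sum x hc) f) =
          (DufloSerganova.CartanPair.dsComp k g x hc f :
            AddMonoidAlgebra ℤ (Module.Dual ℂ (DufloSerganova.CartanPair.iter k g x hc).cartan)) := by
  obtain ⟨D⟩ := DufloSerganova.CartanPair.InvariantForm.nonempty_oppositeFrame (F := F) hg hx
    hβ.independent
  have hc := hβ.sq_eq_zero hg hx
  let c := D.contraction hg hx hβ
  exact ⟨hc, c.iso hc, c.iso_evenClass hc, c.iso_oddClass hc, c.transport_iso_dsHom hc⟩
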